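/- Work over $\mathbb{C}$. For a $\mathbb{C}$-scheme $X$ and $d\ge 0$, let $\mathrm{Hilb}^d(X)$ be the scheme representing the functor that sends a $\mathbb{C}$-scheme $U$ to the set of closed subschemes $Z\subset U\times X$ that are finite and locally free of rank $d$ over $U$. Let $$X=\mathrm{Spec}\,\mathbb{C}[x,y,z,w]/\langle xz-y^2,\ xw-yz,\ yw-z^2\rangle\subset\mathbb{A}^4$$ be the affine cone over the twisted cubic. Then $\mathrm{Hilb}^8(X)$ is reducible, that is, its underlying topological space is non-empty and not irreducible. Moreover, for the ideal $$J=\langle x^2,\ y^2,\ z^2,\ w^2,\ xz,\ yw,\ xw-yz\rangle\subset\mathbb{C}[x,y,z,w],$$ the closed subscheme $Z=\mathrm{Spec}\,\mathbb{C}[x,y,z,w]/J$ of $\mathbb{A}^4$ has length $8$ and lies on $X$, so it defines $\mathbb{C}$-points of $\mathrm{Hilb}^8(X)$ and of $\mathrm{Hilb}^8(\mathbb{A}^4)$, and the Zariski tangent space of $\mathrm{Hilb}^8(\mathbb{A}^4)$ at $[Z]$ has dimension $25$, which is less than $32=4\cdot 8$. -/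

import Mathlib

open CategoryTheory Limits AlgebraicGeometry

noncomputable section

namespace HilbertOfPoints

/-- Schemes over `ℂ`. -/
abbrev SchC : Type 1 := Over (Spec (CommRingCat.of ℂ))

/-- The final `ℂ`-scheme `Spec ℂ`. -/
abbrev ptC : SchC := Over.mk (𝟙 (Spec (CommRingCat.of ℂ)))

/-- `Spec A` as a scheme over `ℂ`, for a `ℂ`-algebra `A`. -/
abbrev specC (A : Type) [CommRing A] [Algebra ℂ A] : SchC :=
  Over.mk (Spec.map (CommRingCat.ofHom (algebraMap ℂ A)))

/-- The fibre product `U × X` over `Spec ℂ`. -/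
abbrev prodC (U X : SchC) : Scheme.{0} := pullback U.hom X.hom

/-- The morphism `f × id : U × X ⟶ V × X`. -/
def prodMap (X : SchC) {U V : SchC} (f : U ⟶ V) : prodC U X ⟶ prodC V X :=
  pullback.lift (pullback.fst _ _ ≫ f.left) (pullback.snd _ _) (by
    rw [Category.assoc, Over.w, pullback.condition])

/-- The projection `Z ⟶ U` of the closed subscheme `Z ⊆ U × X` with ideal sheaf `I`. -/
abbrev familyProj {X U : SchC} (I : (prodC U X).IdealSheafData) : I.subscheme ⟶ U.left :=
  I.subschemeι ≫ pullback.fst U.hom X.hom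

/-- The closed subscheme of `U × X` with ideal sheaf `I` is a flat family of length `d` subschemes
of `X` over `U`: it is finite and locally free over `U`, of rank `d` at every point. -/
structure IsFamily {X U : SchC} (d : ℕ) (I : (prodC U X).IdealSheafData) : Prop where
  finite : IsFinite (familyProj I)
  flat : Flat (familyProj I)
  fin_pres : LocallyOfFinitePresentation (familyProj I)
  rank (u : U.left) : (familyProj I).finrank u = d

theorem prodMap_fst (X : SchC) {U V : SchC} (f : U ⟶ V) :
    prodMap X f ≫ pullback.fst V.hom X.hom = pullback.fst U.hom X.hom ≫ f.left :=
  pullback.lift_fst _ _ _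

theorem prodMap_snd (X : SchC) {U V : SchC} (f : U ⟶ V) :
    prodMap X f ≫ pullback.snd V.hom X.hom = pullback.snd U.hom X.hom :=
  pullback.lift_snd _ _ _

theorem prodMap_id (X U : SchC) : prodMap X (𝟙 U) = 𝟙 _ := by
  apply pullback.hom_ext <;> simp [prodMap_fst, prodMap_snd]

theorem prodMap_comp (X : SchC) {U V W : SchC} (f : U ⟶ V) (g : V ⟶ W) :
    prodMap X (f ≫ g) = prodMap X f ≫ prodMap X g := by
  apply pullback.hom_ext <;> simp [prodMap_fst, prodMap_snd, reassoc_of% prodMap_fst X f]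

theorem prodMap_isPullback (X : SchC) {U V : SchC} (f : U ⟶ V) :
    IsPullback (prodMap X f) (pullback.fst U.hom X.hom) (pullback.fst V.hom X.hom) f.left := by
  refine IsPullback.of_right ?_ (prodMap_fst X f) (IsPullback.of_hasPullback V.hom X.hom).flip
  rw [prodMap_snd, Over.w]
  exact (IsPullback.of_hasPullback U.hom X.hom).flip

theorem familyProj_isPullback (X : SchC) {U V : SchC} (f : U ⟶ V)
    (I : (prodC V X).IdealSheafData) :
    IsPullback ((I.comapIso (prodMap X f)).hom ≫ pullback.snd _ _)
      (familyProj (I.comap (prodMap X f))) (familyProj I) f.left := by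
  have h₁ : IsPullback ((I.comapIso (prodMap X f)).hom ≫ pullback.snd _ _)
      (I.comap (prodMap X f)).subschemeι I.subschemeι (prodMap X f) :=
    (IsPullback.of_iso (IsPullback.of_hasPullback (prodMap X f) I.subschemeι)
      (I.comapIso (prodMap X f)).symm (Iso.refl _) (Iso.refl _) (Iso.refl _)
      (by simp) (by simp [-Scheme.IdealSheafData.comapIso_hom_snd]) (by simp) (by simp)).flip
  exact h₁.paste_vert (prodMap_isPullback X f)

theorem IsFamily.comap {X U V : SchC} (f : U ⟶ V) {d : ℕ} {I : (prodC V X).IdealSheafData}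
    (h : IsFamily d I) : IsFamily d (I.comap (prodMap X f)) := by
  have hp := familyProj_isPullback X f I
  have := h.finite
  have := h.flat
  refine ⟨MorphismProperty.of_isPullback hp h.finite, MorphismProperty.of_isPullback hp h.flat,
    MorphismProperty.of_isPullback hp h.fin_pres, fun u => ?_⟩
  rw [← h.rank (f.left u)]
  exact Scheme.Hom.finrank_of_isPullback _ _ _ _ hp _

/-- The Hilbert functor of `d` points on `X`: a `ℂ`-scheme `U` is sent to the set of closed
subschemes of `U × X` (given by their ideal sheaves) that are flat and finite of degree `d`
over `U`, and a morphism `U ⟶ V` to the pullback of such subschemes along `U × X ⟶ V × X`. -/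
def hilbFunctor (X : SchC) (d : ℕ) : SchCᵒᵖ ⥤ Type where
  obj U := {I : (prodC U.unop X).IdealSheafData // IsFamily d I}
  map f := TypeCat.ofHom fun I => ⟨I.1.comap (prodMap X f.unop), I.2.comap f.unop⟩
  map_id U := by
    refine ConcreteCategory.hom_ext _ _ fun I => Subtype.ext ?_
    change I.1.comap (prodMap X (𝟙 U.unop)) = I.1
    rw [prodMap_id, Scheme.IdealSheafData.comap_id]
  map_comp f g := by
    refine ConcreteCategory.hom_ext _ _ fun I => Subtype.ext ?_
    change I.1.comap (prodMap X (g.unop ≫ f.unop)) =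
      (I.1.comap (prodMap X f.unop)).comap (prodMap X g.unop)
    rw [prodMap_comp, Scheme.IdealSheafData.comap_comp]

/-- The ideal sheaf on `Spec ℂ × Spec A` of the closed subscheme `Spec (A ⧸ J)` of `Spec A`. -/
def closedSubscheme {A : Type} [CommRing A] [Algebra ℂ A] (J : Ideal A) :
    (prodC ptC (specC A)).IdealSheafData :=
  (Scheme.Hom.ker (Spec.map (CommRingCat.ofHom (Ideal.Quotient.mk J)))).comap
    (pullback.snd ptC.hom (specC A).hom)

/-- The point of `H` that is the image of a `ℂ`-valued point `Spec ℂ ⟶ H`. -/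
def imagePoint {H : SchC} (f : ptC ⟶ H) : H.left :=
  f.left (IsLocalRing.closedPoint ℂ)

/-- The dimension of the Zariski tangent space `(𝔪 / 𝔪²)^*` of a scheme at a point, over the
residue field of the point. -/
def tangentDim (Y : Scheme.{0}) (y : Y) : ℕ :=
  Module.finrank (IsLocalRing.ResidueField (Y.presheaf.stalk y))
    (Module.Dual (IsLocalRing.ResidueField (Y.presheaf.stalk y))
      (IsLocalRing.CotangentSpace (Y.presheaf.stalk y)))

/-- The coordinate ring `ℂ[x, y, z, w]` of affine 4-space; `x, y, z, w` are `X 0, X 1, X 2, X 3`. -/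
abbrev Poly4 : Type := MvPolynomial (Fin 4) ℂ

open MvPolynomial in
/-- The ideal `(xz - y², xw - yz, yw - z²)` of the affine cone over the twisted cubic. -/
def coneIdeal : Ideal Poly4 :=
  Ideal.span {X 0 * X 2 - X 1 ^ 2, X 0 * X 3 - X 1 * X 2, X 1 * X 3 - X 2 ^ 2}

/-- The affine 4-space over `ℂ`. -/
abbrev affine4 : SchC := specC Poly4

/-- The affine cone over the twisted cubic. -/
abbrev twistedCone : SchC := specC (Poly4 ⧸ coneIdeal)

open MvPolynomial in
/-- The ideal `(x², y², z², w², xz, yw, xw - yz)`. -/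
def pointIdeal : Ideal Poly4 :=
  Ideal.span {X 0 ^ 2, X 1 ^ 2, X 2 ^ 2, X 3 ^ 2, X 0 * X 2, X 1 * X 3, X 0 * X 3 - X 1 * X 2}

end HilbertOfPoints

end

/-! Reducibility comes from two open conditions on the coordinate algebra C of a fibre which exclude
each other over a field, while each holds at some ℂ-point of the Hilbert scheme of the cone. The
first is nondegeneracy of the trace form; eight distinct points of the cone satisfy it. The second
asks for three linear forms φ_i on C such that the alternating form (a, b) ↦ Σ φ_i((a × b)_i) on C³
has rank at least 18; Z satisfies it (`QuadricAlgebra.hasCrossRank`). If the trace form is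
nondegenerate, then C is reduced and φ_i = Tr(f_i ·), so the alternating form is Tr((f × a) · b). A
nonzero cross product operator over a field has rank 2, so the rank is at most 2 · 8 = 16
(`not_hasCrossRank`). On an irreducible Hilbert scheme the generic point specializes to both
ℂ-points. A determinant that is a unit at a closed point is a unit in the local ring there, so the
fibre over the residue field of the generic point would satisfy both conditions
(`exists_common_generization`, `not_irreducibleSpace`).

The tangent space is computed from an explicit family. Every choice of the 7 · 3 products `x², y²,
z², w², xz, yw, xw` in terms of `xy, yz, zw` gives a free algebra of rank 8, since all products of
degree three vanish. Together with the 4 translations this yields 25 parameters. The resulting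
deformation over ℂ ⊕ V with V = ℂ²⁵ induces every deformation of Z over the dual numbers exactly
once: the parameters are visible in the values on the generators (`defIdeal_injective`), and the
linear syzygies of the generators leave room for no other values (`exists_defIdeal_eq`). The
universal property of the local ring then identifies its cotangent space with V. -/

open CategoryTheory Limits AlgebraicGeometry TensorProduct
noncomputable section
namespace HilbertOfPoints

/-! ### Ideal sheaves on affine schemes. -/

section Affine

/-- On an affine scheme, inclusion of kernels of morphisms of spectra is inclusion of kernels of
ring homomorphisms. -/
theorem kerSpecMap_le_iff {T B C : CommRingCat.{0}} (φ : T ⟶ B) (ψ : T ⟶ C) :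
    (Spec.map φ).ker ≤ (Spec.map ψ).ker ↔ RingHom.ker φ.hom ≤ RingHom.ker ψ.hom := by
  have key {B : CommRingCat.{0}} (φ : T ⟶ B) (x : T) :
      x ∈ RingHom.ker φ.hom ↔ (Scheme.ΓSpecIso T).inv.hom x ∈
        (Spec.map φ).ker.ideal ⟨⊤, isAffineOpen_top _⟩ := by
    rw [Scheme.Hom.ker_apply, RingHom.mem_ker, RingHom.mem_ker]
    have h := congr($(Scheme.ΓSpecIso_inv_naturality φ) x)
    change (Scheme.ΓSpecIso B).inv.hom (φ.hom x) =
      (Spec.map φ).appTop.hom ((Scheme.ΓSpecIso T).inv.hom x) at h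
    change _ ↔ (Spec.map φ).appTop.hom ((Scheme.ΓSpecIso T).inv.hom x) = 0
    rw [← h, map_eq_zero_iff _ (ConcreteCategory.bijective_of_isIso (Scheme.ΓSpecIso B).inv).1]
  constructor
  · intro h x hx
    rw [key] at hx ⊢
    exact h _ hx
  · intro h
    refine Scheme.IdealSheafData.le_of_isAffine fun y hy => ?_
    obtain ⟨x, rfl⟩ := (ConcreteCategory.bijective_of_isIso (Scheme.ΓSpecIso T).inv).2 y
    exact (key ψ x).1 (h ((key φ x).2 hy))

theorem exists_kerSpecMap_eq {T : CommRingCat.{0}} (K : (Spec T).IdealSheafData) :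
    ∃ I : Ideal T, K = (Spec.map (CommRingCat.ofHom (Ideal.Quotient.mk I))).ker := by
  obtain ⟨I, e, he⟩ := IsClosedImmersion.Spec_iff.1
    (inferInstance : IsClosedImmersion K.subschemeι)
  refine ⟨I, ?_⟩
  conv_lhs => rw [← K.ker_subschemeι, he]
  exact Scheme.Hom.ker_comp_of_isIso _ _

end Affine

/-! ### Families over an affine base as ideals of `A ⊗ S`. -/

section Families

variable {A A' S : Type} [CommRing A] [Algebra ℂ A] [CommRing A'] [Algebra ℂ A']
  [CommRing S] [Algebra ℂ S]

/-- The closed subscheme of `Spec A × Spec S` that is the image of `Spec B`. -/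
def kerOf {B : Type} [CommRing B] (φ : A ⊗[ℂ] S →+* B) :
    (prodC (specC A) (specC S)).IdealSheafData :=
  Scheme.Hom.ker (Spec.map (CommRingCat.ofHom φ) ≫ (pullbackSpecIso ℂ A S).inv)

theorem kerOf_le_iff {B C : Type} [CommRing B] [CommRing C] (φ : A ⊗[ℂ] S →+* B)
    (ψ : A ⊗[ℂ] S →+* C) : kerOf φ ≤ kerOf ψ ↔ RingHom.ker φ ≤ RingHom.ker ψ := by
  rw [← CommRingCat.hom_ofHom φ, ← CommRingCat.hom_ofHom ψ, ← kerSpecMap_le_iff, kerOf, kerOf,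
    ← Scheme.IdealSheafData.map_ker, ← Scheme.IdealSheafData.map_ker]
  constructor
  · intro h
    have h' := Scheme.IdealSheafData.map_mono (pullbackSpecIso ℂ A S).hom h
    simpa only [← Scheme.IdealSheafData.map_comp, Iso.inv_hom_id,
      Scheme.IdealSheafData.map_id] using h'
  · exact fun h => Scheme.IdealSheafData.map_mono _ h

/-- The closed subscheme of `Spec A × Spec S` cut out by an ideal of `A ⊗ S`. -/
def famOf (I : Ideal (A ⊗[ℂ] S)) : (prodC (specC A) (specC S)).IdealSheafData :=
  kerOf (Ideal.Quotient.mk I)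

theorem kerOf_eq_famOf {B : Type} [CommRing B] (φ : A ⊗[ℂ] S →+* B) :
    kerOf φ = famOf (RingHom.ker φ) :=
  le_antisymm ((kerOf_le_iff _ _).2 (by rw [Ideal.mk_ker]))
    ((kerOf_le_iff _ _).2 (by rw [Ideal.mk_ker]))

theorem famOf_le_iff (I J : Ideal (A ⊗[ℂ] S)) : famOf I ≤ famOf J ↔ I ≤ J := by
  rw [famOf, famOf, kerOf_le_iff, Ideal.mk_ker, Ideal.mk_ker]

theorem famOf_injective : Function.Injective (famOf (A := A) (S := S)) := fun _ _ h =>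
  le_antisymm ((famOf_le_iff _ _).1 h.le) ((famOf_le_iff _ _).1 h.ge)

theorem famOf_surjective : Function.Surjective (famOf (A := A) (S := S)) := by
  intro K
  obtain ⟨I, hI⟩ := exists_kerSpecMap_eq (K.map (pullbackSpecIso ℂ A S).hom)
  refine ⟨I, ?_⟩
  have h := congr(Scheme.IdealSheafData.map $hI (pullbackSpecIso ℂ A S).inv)
  rw [← Scheme.IdealSheafData.map_comp, Iso.hom_inv_id, Scheme.IdealSheafData.map_id,
    Scheme.IdealSheafData.map_ker] at h
  exact h.symm

/-- The morphism of `ℂ`-schemes induced by a homomorphism of algebras. -/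
def specMap (g : A →ₐ[ℂ] A') : specC A' ⟶ specC A :=
  Over.homMk (Spec.map (CommRingCat.ofHom g.toRingHom)) (by
    simp only [Over.mk_hom, ← Spec.map_comp, ← CommRingCat.ofHom_comp]
    congr 2
    exact g.comp_algebraMap)

theorem pullbackSpecIso_inv_prodMap (g : A →ₐ[ℂ] A') :
    (pullbackSpecIso ℂ A' S).inv ≫ prodMap (specC S) (specMap g) =
      Spec.map (CommRingCat.ofHom (Algebra.TensorProduct.map g (AlgHom.id ℂ S)).toRingHom) ≫
        (pullbackSpecIso ℂ A S).inv := by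
  have h1 : (pullbackSpecIso ℂ A' S).inv ≫ pullback.fst (specC A').hom (specC S).hom =
    Spec.map (CommRingCat.ofHom Algebra.TensorProduct.includeLeftRingHom) := pullbackSpecIso_inv_fst ..
  have h2 : (pullbackSpecIso ℂ A S).inv ≫ pullback.fst (specC A).hom (specC S).hom =
    Spec.map (CommRingCat.ofHom Algebra.TensorProduct.includeLeftRingHom) := pullbackSpecIso_inv_fst ..
  have h3 : (pullbackSpecIso ℂ A' S).inv ≫ pullback.snd (specC A').hom (specC S).hom =
    Spec.map (CommRingCat.ofHom (Algebra.TensorProduct.includeRight.toRingHom)) :=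
      pullbackSpecIso_inv_snd ..
  have h4 : (pullbackSpecIso ℂ A S).inv ≫ pullback.snd (specC A).hom (specC S).hom =
    Spec.map (CommRingCat.ofHom (Algebra.TensorProduct.includeRight.toRingHom)) :=
      pullbackSpecIso_inv_snd ..
  apply pullback.hom_ext
  · rw [Category.assoc, prodMap_fst, Category.assoc, h2, reassoc_of% h1]
    change _ ≫ Spec.map _ = _
    rw [← Spec.map_comp, ← Spec.map_comp, ← CommRingCat.ofHom_comp, ← CommRingCat.ofHom_comp]
    congr 2
  · rw [Category.assoc, prodMap_snd, Category.assoc, h3, h4, ← Spec.map_comp,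
      ← CommRingCat.ofHom_comp]
    congr 2
    ext a
    simp
-- Pullback and pushforward of ideal sheaves form a Galois connection, as do `Ideal.map` and
-- `Ideal.comap`. Pushforward is easy to compute on kernels, so the two sides are compared through
-- their upper bounds.
theorem famOf_comap (g : A →ₐ[ℂ] A') (I : Ideal (A ⊗[ℂ] S)) :
    (famOf I).comap (prodMap (specC S) (specMap g)) =
      famOf (I.map (Algebra.TensorProduct.map g (AlgHom.id ℂ S))) := by
  refine eq_of_forall_ge_iff fun K => ?_
  obtain ⟨K, rfl⟩ := famOf_surjective K
  have h : (famOf K).map (prodMap (specC S) (specMap g)) = famOf (K.comap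
      (Algebra.TensorProduct.map g (AlgHom.id ℂ S))) := by
    rw [famOf, kerOf, Scheme.IdealSheafData.map_ker, Category.assoc, pullbackSpecIso_inv_prodMap,
      ← Category.assoc, ← Spec.map_comp, ← CommRingCat.ofHom_comp]
    refine (kerOf_eq_famOf _).trans ?_
    congr 1
    rw [← RingHom.comap_ker, Ideal.mk_ker]
    rfl
  rw [famOf_le_iff, Ideal.map_le_iff_le_comap, ← famOf_le_iff, ← h,
    Scheme.IdealSheafData.le_map_iff_comap_le]

/-- The ideal `I` of `A ⊗ S` defines a family of subschemes of `Spec S` of length `d`. -/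
structure IsAlgFamily (d : ℕ) (I : Ideal (A ⊗[ℂ] S)) : Prop where
  finite : Module.Finite A ((A ⊗[ℂ] S) ⧸ I)
  flat : Module.Flat A ((A ⊗[ℂ] S) ⧸ I)
  fin_pres : Algebra.FinitePresentation A ((A ⊗[ℂ] S) ⧸ I)
  rank (p : PrimeSpectrum A) : Module.rankAtStalk ((A ⊗[ℂ] S) ⧸ I) p = d

theorem exists_iso_familyProj {X U : SchC} {Z : Scheme.{0}} (j : Z ⟶ prodC U X)
    [IsClosedImmersion j] : ∃ e : Z ⟶ j.ker.subscheme, IsIso e ∧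
      e ≫ familyProj j.ker = j ≫ pullback.fst U.hom X.hom :=
  ⟨j.toImage, inferInstanceAs (IsIso j.toImage), by
    rw [familyProj, ← Category.assoc]
    congr 1
    exact j.toImage_imageι⟩

theorem finrank_eq_of_comp_eq {X Y Z : Scheme.{0}} (e : X ⟶ Y) [IsIso e] (f : Y ⟶ Z) (_ : Flat f)
    (_ : IsFinite f) (g : X ⟶ Z) (h : e ≫ f = g) (z : Z) : f.finrank z = g.finrank z := by
  rw [← h, Scheme.Hom.finrank_comp_left_of_isIso]

/-- Up to an isomorphism of the source, the projection of the family is the spectrum of `A → (A ⊗ S)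
⧸ I`, so each geometric condition becomes the algebraic one. -/
theorem isFamily_famOf_iff (d : ℕ) (I : Ideal (A ⊗[ℂ] S)) :
    IsFamily d (famOf I) ↔ IsAlgFamily d I := by
  let j : Spec (.of ((A ⊗[ℂ] S) ⧸ I)) ⟶ prodC (specC A) (specC S) :=
    Spec.map (CommRingCat.ofHom (Ideal.Quotient.mk I)) ≫ (pullbackSpecIso ℂ A S).inv
  have hj : IsClosedImmersion (Spec.map (CommRingCat.ofHom (Ideal.Quotient.mk I))) :=
    IsClosedImmersion.spec_of_surjective _ Ideal.Quotient.mk_surjective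
  have : IsClosedImmersion j :=
    inferInstanceAs (IsClosedImmersion (Spec.map _ ≫ (pullbackSpecIso ℂ A S).inv))
  obtain ⟨e, he, h⟩ := exists_iso_familyProj j
  have hp : e ≫ familyProj (famOf I) =
      Spec.map (CommRingCat.ofHom (algebraMap A ((A ⊗[ℂ] S) ⧸ I))) := by
    refine h.trans ((Category.assoc _ _ _).trans ?_)
    have h1 : (pullbackSpecIso ℂ A S).inv ≫ pullback.fst (specC A).hom (specC S).hom =
      Spec.map (CommRingCat.ofHom Algebra.TensorProduct.includeLeftRingHom) :=
        pullbackSpecIso_inv_fst ..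
    rw [h1, ← Spec.map_comp, ← CommRingCat.ofHom_comp]
  have key (P : MorphismProperty Scheme.{0}) [P.IsStableUnderBaseChange] :
      P (familyProj (famOf I)) ↔
        P (Spec.map (CommRingCat.ofHom (algebraMap A ((A ⊗[ℂ] S) ⧸ I)))) := by
    have : P.RespectsIso := MorphismProperty.IsStableUnderBaseChange.respectsIso
    rw [← hp]
    exact (MorphismProperty.cancel_left_of_respectsIso P e _).symm
  have h1 : IsFinite (familyProj (famOf I)) ↔ Module.Finite A ((A ⊗[ℂ] S) ⧸ I) :=
    (key @IsFinite).trans ((IsFinite.SpecMap_iff _).trans RingHom.finite_algebraMap)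
  have h2 : Flat (familyProj (famOf I)) ↔ Module.Flat A ((A ⊗[ℂ] S) ⧸ I) :=
    (key @Flat).trans (Flat.SpecMap_iff.trans RingHom.flat_algebraMap_iff)
  have h3 : LocallyOfFinitePresentation (familyProj (famOf I)) ↔
      Algebra.FinitePresentation A ((A ⊗[ℂ] S) ⧸ I) :=
    (key @LocallyOfFinitePresentation).trans
      ((LocallyOfFinitePresentation.SpecMap_iff _).trans RingHom.finitePresentation_algebraMap)
  have h4 (x : PrimeSpectrum A) (_ : IsFinite (familyProj (famOf I)))
      (_ : Flat (familyProj (famOf I)))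
      (_ : Module.Finite A ((A ⊗[ℂ] S) ⧸ I)) (_ : Module.Flat A ((A ⊗[ℂ] S) ⧸ I)) :
      (familyProj (famOf I)).finrank x = Module.rankAtStalk ((A ⊗[ℂ] S) ⧸ I) x :=
    (finrank_eq_of_comp_eq e _ ‹_› ‹_› _ hp x).trans (Scheme.Hom.finrank_SpecMap_algebraMap _ _ x)
  constructor
  · rintro ⟨a, b, c, e⟩
    have := h1.1 a
    have := h2.1 b
    exact ⟨‹_›, ‹_›, h3.1 c, fun x => (h4 x ‹_› ‹_› ‹_› ‹_›).symm.trans (e x)⟩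
  · rintro ⟨a, b, c, e⟩
    have := h1.2 a
    have := h2.2 b
    exact ⟨‹_›, ‹_›, h3.2 c, fun x => (h4 x ‹_› ‹_› ‹_› ‹_›).trans (e x)⟩

end Families

/-! ### Constant families and the two models of the point `Spec ℂ`. -/

variable {A A' A'' S : Type} [CommRing A] [Algebra ℂ A] [CommRing A'] [Algebra ℂ A']
  [CommRing A''] [Algebra ℂ A''] [CommRing S] [Algebra ℂ S]

theorem specMap_comp (g : A →ₐ[ℂ] A') (h : A' →ₐ[ℂ] A'') :
    specMap (h.comp g) = specMap h ≫ specMap g := by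
  ext1
  exact Spec.map_comp (CommRingCat.ofHom g.toRingHom) (CommRingCat.ofHom h.toRingHom)

/-- The same adjunction argument as in `famOf_comap`, now for the second projection. -/
theorem ker_comap_snd (J : Ideal S) :
    (Scheme.Hom.ker (Spec.map (CommRingCat.ofHom (Ideal.Quotient.mk J)))).comap
      (pullback.snd (specC A).hom (specC S).hom) =
      famOf (J.map (Algebra.TensorProduct.includeRight : S →ₐ[ℂ] A ⊗[ℂ] S)) := by
  refine eq_of_forall_ge_iff fun K => ?_
  obtain ⟨K, rfl⟩ := famOf_surjective K
  have h3 : (pullbackSpecIso ℂ A S).inv ≫ pullback.snd (specC A).hom (specC S).hom =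
    Spec.map (CommRingCat.ofHom (Algebra.TensorProduct.includeRight.toRingHom)) :=
      pullbackSpecIso_inv_snd ..
  rw [famOf_le_iff, Ideal.map_le_iff_le_comap, ← Scheme.IdealSheafData.le_map_iff_comap_le, famOf,
    kerOf, Scheme.IdealSheafData.map_ker, Category.assoc, h3, ← Spec.map_comp,
    ← CommRingCat.ofHom_comp, kerSpecMap_le_iff]
  change RingHom.ker (Ideal.Quotient.mk J) ≤
    RingHom.ker ((Ideal.Quotient.mk K).comp Algebra.TensorProduct.includeRight.toRingHom) ↔ _
  rw [Ideal.mk_ker, ← RingHom.comap_ker, Ideal.mk_ker]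
  rfl

theorem specMap_ofHom_eq_id {R : Type} [CommRing R] (φ : R →+* R) (h : ∀ x, φ x = x) :
    Spec.map (CommRingCat.ofHom φ) = 𝟙 (Spec (CommRingCat.of R)) := by
  rw [show φ = RingHom.id R from RingHom.ext h, CommRingCat.ofHom_id, Spec.map_id]

theorem specMap_algebraMap_complex :
    Spec.map (CommRingCat.ofHom (@algebraMap ℂ ℂ _
      (CommSemiring.toSemiring (self := CommRing.toCommSemiring)) _)) =
      𝟙 (Spec (CommRingCat.of ℂ)) :=
  specMap_ofHom_eq_id _ fun _ => rfl

/-- An object over `T` whose structure morphism is the identity is isomorphic to the final one. -/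
def overMkIso {C : Type*} [Category C] {T : C} {p : T ⟶ T} (h : p = 𝟙 T) :
    Over.mk p ≅ Over.mk (𝟙 T) :=
  Over.isoMk (Iso.refl T) (by simp [h])

/-- The canonical isomorphism from `Spec ℂ`, with structure morphism induced by `algebraMap ℂ ℂ`,
to the final `ℂ`-scheme. -/
def ptIso : specC ℂ ≅ ptC := overMkIso specMap_algebraMap_complex

theorem closedSubscheme_comap (J : Ideal S) :
    (closedSubscheme J).comap (prodMap (specC S) ptIso.hom) =
      famOf (J.map (Algebra.TensorProduct.includeRight : S →ₐ[ℂ] ℂ ⊗[ℂ] S)) := by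
  rw [closedSubscheme, ← Scheme.IdealSheafData.comap_comp, prodMap_snd, ker_comap_snd]

theorem isFamily_closedSubscheme {d : ℕ} {J : Ideal S} (h : IsAlgFamily d
    (J.map (Algebra.TensorProduct.includeRight : S →ₐ[ℂ] ℂ ⊗[ℂ] S))) :
    IsFamily d (closedSubscheme J) := by
  have h' := ((isFamily_famOf_iff _ _).2 h).comap ptIso.inv
  rwa [← closedSubscheme_comap, ← Scheme.IdealSheafData.comap_comp, ← prodMap_comp, Iso.inv_hom_id,
    prodMap_id, Scheme.IdealSheafData.comap_id] at h'

/-! ### Affine-valued points of the Hilbert scheme as ideals. -/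

section Points

variable {d : ℕ} {H : SchC} (r : (hilbFunctor (specC S) d).RepresentableBy H)

/-- The ideal of `A ⊗ S` that defines the family over `Spec A` classified by a morphism from
`Spec A` to the Hilbert scheme. -/
def idealOf (f : specC A ⟶ H) : Ideal (A ⊗[ℂ] S) :=
  (famOf_surjective (r.homEquiv f).1).choose

theorem famOf_idealOf (f : specC A ⟶ H) : famOf (idealOf r f) = (r.homEquiv f).1 :=
  (famOf_surjective (r.homEquiv f).1).choose_spec

theorem isAlgFamily_idealOf (f : specC A ⟶ H) : IsAlgFamily d (idealOf r f) := by
  rw [← isFamily_famOf_iff, famOf_idealOf]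
  exact (r.homEquiv f).2

/-- Naturality of the representation in algebraic form: precomposition with a morphism of spectra is
extension of ideals. -/
theorem idealOf_comp (g : A →ₐ[ℂ] A') (f : specC A ⟶ H) :
    idealOf r (specMap g ≫ f) =
      (idealOf r f).map (Algebra.TensorProduct.map g (AlgHom.id ℂ S)) := by
  apply famOf_injective
  rw [famOf_idealOf, r.homEquiv_comp, ← famOf_comap, famOf_idealOf]
  rfl

theorem idealOf_injective : Function.Injective (idealOf r (A := A)) := by
  intro f f' h
  apply r.homEquiv.injective
  refine Subtype.ext ?_
  rw [← famOf_idealOf, ← famOf_idealOf, h]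

theorem exists_idealOf_eq {I : Ideal (A ⊗[ℂ] S)} (h : IsAlgFamily d I) :
    ∃ f : specC A ⟶ H, idealOf r f = I := by
  refine ⟨r.homEquiv.symm ⟨famOf I, (isFamily_famOf_iff _ _).2 h⟩, famOf_injective ?_⟩
  rw [famOf_idealOf]
  exact congrArg Subtype.val (r.homEquiv.apply_symm_apply _)

theorem idealOf_ptIso_comp {J : Ideal S} (z : (hilbFunctor (specC S) d).obj (Opposite.op ptC))
    (hz : z.1 = closedSubscheme J) :
    idealOf r (ptIso.hom ≫ r.homEquiv.symm z) =
      J.map (Algebra.TensorProduct.includeRight : S →ₐ[ℂ] ℂ ⊗[ℂ] S) := by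
  apply famOf_injective
  rw [famOf_idealOf, r.homEquiv_comp, Equiv.apply_symm_apply, ← closedSubscheme_comap, ← hz]
  rfl

end Points

/-! ### Local rings of a ℂ-scheme. -/

section Stalks

variable (H : SchC) (x : H.left)

/-- The local ring of a `ℂ`-scheme at a point. -/
def LocalRingAt : Type := H.left.presheaf.stalk x

instance : CommRing (LocalRingAt H x) :=
  inferInstanceAs (CommRing (H.left.presheaf.stalk x))

instance : IsLocalRing (LocalRingAt H x) :=
  inferInstanceAs (IsLocalRing (H.left.presheaf.stalk x))

instance : Algebra ℂ (LocalRingAt H x) :=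
  RingHom.toAlgebra (Spec.preimage (H.left.fromSpecStalk x ≫ H.hom)).hom

/-- The canonical morphism from the spectrum of the local ring at a point. -/
def fromLocalRing : specC (LocalRingAt H x) ⟶ H :=
  Over.homMk (H.left.fromSpecStalk x) (by
    change _ = Spec.map (Spec.preimage (H.left.fromSpecStalk x ≫ H.hom))
    exact (Spec.map_preimage _).symm)

variable {H x}

/-- The morphism from the spectrum of a stalk is a monomorphism. -/
theorem specMap_fromLocalRing_injective {g g' : LocalRingAt H x →ₐ[ℂ] A}
    (h : specMap g ≫ fromLocalRing H x = specMap g' ≫ fromLocalRing H x) : g = g' := by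
  have h' : Spec.map (CommRingCat.ofHom g.toRingHom) ≫ H.left.fromSpecStalk x =
    Spec.map (CommRingCat.ofHom g'.toRingHom) ≫ H.left.fromSpecStalk x :=
      congr(($h).left)
  have h2 := Spec.map_injective ((cancel_mono (H.left.fromSpecStalk x)).1 h')
  ext a
  exact congr(($h2).hom a)

theorem exists_specMap_fromLocalRing [IsLocalRing A] (f : specC A ⟶ H)
    (hf : f.left (IsLocalRing.closedPoint A) = x) :
    ∃ g : LocalRingAt H x →ₐ[ℂ] A, IsLocalHom g ∧ specMap g ≫ fromLocalRing H x = f := by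
  subst hf
  let φ := Scheme.stalkClosedPointTo f.left
  have h1 : Spec.map φ ≫ H.left.fromSpecStalk _ = f.left :=
    Scheme.Spec_stalkClosedPointTo_fromSpecStalk f.left
  have h2 : Spec.preimage (H.left.fromSpecStalk _ ≫ H.hom) ≫ φ =
      CommRingCat.ofHom (algebraMap ℂ A) := by
    apply Spec.map_injective
    rw [Spec.map_comp, Spec.map_preimage, reassoc_of% h1]
    exact Over.w f
  refine ⟨⟨φ.hom, fun c => congr(($h2).hom c)⟩,
    ⟨(inferInstance : IsLocalHom φ.hom).1⟩, ?_⟩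
  ext1
  exact h1

/-- The homomorphism of local rings attached to a specialization. -/
theorem exists_localRingAt_hom {x y : H.left} (h : y ⤳ x) :
    ∃ g : LocalRingAt H x →ₐ[ℂ] LocalRingAt H y,
      specMap g ≫ fromLocalRing H x = fromLocalRing H y := by
  have h1 : Spec.map (H.left.presheaf.stalkSpecializes h) ≫ H.left.fromSpecStalk x =
    H.left.fromSpecStalk y := Scheme.SpecMap_stalkSpecializes_fromSpecStalk h
  have h2 : Spec.preimage (H.left.fromSpecStalk x ≫ H.hom) ≫
      H.left.presheaf.stalkSpecializes h = Spec.preimage (H.left.fromSpecStalk y ≫ H.hom) := by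
    apply Spec.map_injective
    rw [Spec.map_comp, Spec.map_preimage, Spec.map_preimage, reassoc_of% h1]
  refine ⟨⟨(H.left.presheaf.stalkSpecializes h).hom, fun c => congr(($h2).hom c)⟩, ?_⟩
  ext1
  exact h1

end Stalks

/-! ### The alternating form on `C³` given by three linear forms. -/

section Koszul

variable {K C : Type*} [CommRing K] [CommRing C] [Algebra K C]

/-- The alternating form `(a, b) ↦ φ (a × b)` on `C³` defined by three linear forms on `C`. -/
def crossForm (φ : Fin 3 → C →ₗ[K] K) (a b : Fin 3 → C) : K :=
  ∑ i, φ i (crossProduct a b i)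

/-- The algebra `C` carries three linear forms whose alternating form on `C³` has rank at least
`n`. -/
def HasCrossRank (K C : Type*) [CommRing K] [CommRing C] [Algebra K C] (n : ℕ) : Prop :=
  ∃ (φ : Fin 3 → C →ₗ[K] K) (v w : Fin n → Fin 3 → C),
    IsUnit (Matrix.of fun i j => crossForm φ (v i) (w j)).det

theorem HasCrossRank.of_algEquiv {C' : Type*} [CommRing C'] [Algebra K C'] (e : C ≃ₐ[K] C')
    {n : ℕ} (h : HasCrossRank K C n) : HasCrossRank K C' n := by
  obtain ⟨φ, v, w, h⟩ := h
  refine ⟨fun i => φ i ∘ₗ e.symm.toLinearMap, fun i => e ∘ v i, fun i => e ∘ w i, ?_⟩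
  have key (a b : Fin 3 → C) :
      crossForm (fun i => φ i ∘ₗ e.symm.toLinearMap) (e ∘ a) (e ∘ b) = crossForm φ a b := by
    unfold crossForm
    congr 1
    ext k
    fin_cases k <;> simp [cross_apply]
  simpa only [key] using h

end Koszul

/-! ### A nondegenerate trace form bounds the rank of the alternating form. -/

section Trace

variable {K C : Type*} [Field K] [CommRing C] [Algebra K C] [FiniteDimensional K C]

-- If x is nilpotent then so is xy, hence Tr(xy) = 0 for every y and x lies in the radical of the
-- trace form.
omit [FiniteDimensional K C] in
theorem isReduced_of_traceForm_nondegenerate (h : (Algebra.traceForm K C).Nondegenerate) :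
    IsReduced C := by
  refine ⟨fun x hx => h.1 x fun y => ?_⟩
  rw [Algebra.traceForm_apply, Algebra.trace_apply]
  refine IsNilpotent.eq_zero (LinearMap.isNilpotent_trace_of_isNilpotent ?_)
  exact ((Commute.all x y).isNilpotent_mul_right hx).map (Algebra.lmul K C)

/-- The kernel contains C · f and Ann(f) · e₀. Their dimensions add up to dim C by rank-nullity for
c ↦ c f. They meet trivially: if b f = c e₀ with c f = 0, then (b f_i)² = 0, so b f_i = 0 because C
is reduced. -/
theorem finrank_le_finrank_ker_cross [IsReduced C] (f : Fin 3 → C) :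
    Module.finrank K C ≤
      Module.finrank K (LinearMap.ker ((crossProduct f).restrictScalars K)) := by
  let E : C →ₗ[K] (Fin 3 → C) := (LinearMap.toSpanSingleton C _ f).restrictScalars K
  let F : C →ₗ[K] (Fin 3 → C) := LinearMap.single K (fun _ => C) 0
  have hmem (c : C) : c ∈ LinearMap.ker E ↔ ∀ i, c * f i = 0 := by
    simp [E, funext_iff]
  have h1 : LinearMap.range E ≤ LinearMap.ker ((crossProduct f).restrictScalars K) := by
    rintro _ ⟨c, rfl⟩
    simp [E]
  have h2 : (LinearMap.ker E).map F ≤ LinearMap.ker ((crossProduct f).restrictScalars K) := by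
    rintro _ ⟨c, hc, rfl⟩
    have hc' := (hmem c).1 hc
    have h0 (i) : f i * c = 0 := by rw [mul_comm, hc']
    ext i
    fin_cases i <;> simp [F, cross_apply, h0]
  have h3 : LinearMap.range E ⊓ (LinearMap.ker E).map F = ⊥ := by
    rw [eq_bot_iff]
    rintro _ ⟨⟨b, rfl⟩, c, hc, h⟩
    have hc' := (hmem c).1 hc
    have hb (i) : b * f i = F c i := by rw [h]; simp [E]
    suffices ∀ i, b * f i = 0 by
      change E b = 0
      ext i
      simpa [E] using this i
    intro i
    refine IsReduced.eq_zero _ ⟨2, ?_⟩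
    have : F c i * f i = 0 := by
      fin_cases i
      · simpa [F] using hc' 0
      · simp [F]
      · simp [F]
    rw [sq]
    nth_rewrite 1 [hb]
    rw [mul_left_comm, this, mul_zero]
  have h4 := Submodule.finrank_sup_add_finrank_inf_eq (LinearMap.range E) ((LinearMap.ker E).map F)
  rw [h3, finrank_bot, add_zero, ← (Submodule.equivMapOfInjective F
    (Pi.single_injective (M := fun _ => C) 0) (LinearMap.ker E)).finrank_eq] at h4
  rw [← LinearMap.finrank_range_add_finrank_ker E, ← h4]
  exact Submodule.finrank_mono (sup_le h1 h2)

/-- The rank of the form is at most that of a ↦ f × a on C³, that is 3 dim C minus the dimension of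
a kernel which is at least dim C. -/
theorem not_hasCrossRank (h : (Algebra.traceForm K C).Nondegenerate) {n : ℕ}
    (hn : 2 * Module.finrank K C < n) : ¬ HasCrossRank K C n := by
  rintro ⟨φ, v, w, hdet⟩
  have := isReduced_of_traceForm_nondegenerate h
  let f : Fin 3 → C := fun i => ((Algebra.traceForm K C).toDual h).symm (φ i)
  have hf (i c) : φ i c = Algebra.trace K C (f i * c) := by
    have := LinearMap.BilinForm.toDual_def (B := Algebra.traceForm K C) h (m := f i) (n := c)
    rw [LinearEquiv.apply_symm_apply] at this
    exact this
  let L : (Fin 3 → C) →ₗ[K] (Fin 3 → C) := (crossProduct f).restrictScalars K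
  have hΩ (a b : Fin 3 → C) : crossForm φ a b = Algebra.trace K C (L a ⬝ᵥ b) := by
    -- The scalar triple product is cyclically symmetric.
    have : L a ⬝ᵥ b = f ⬝ᵥ crossProduct a b := by
      change crossProduct f a ⬝ᵥ b = _
      rw [triple_product_permutation, triple_product_permutation, dotProduct_comm,
        triple_product_permutation]
    rw [this, dotProduct, map_sum, crossForm]
    exact Finset.sum_congr rfl fun i _ => hf _ _
  have hli : LinearIndependent K (fun i => L (v i)) := by
    rw [Fintype.linearIndependent_iff]
    intro c hc
    have h0 : Matrix.vecMul c (Matrix.of fun i j => crossForm φ (v i) (w j)) = 0 := by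
      ext j
      have := congr(Algebra.trace K C ($hc ⬝ᵥ w j))
      rw [sum_dotProduct, map_sum, zero_dotProduct, map_zero] at this
      simpa only [Matrix.vecMul, dotProduct.eq_1 c, Matrix.of_apply, hΩ, smul_dotProduct, map_smul,
        smul_eq_mul, Pi.zero_apply] using this
    have := Matrix.eq_zero_of_vecMul_eq_zero hdet.ne_zero h0
    exact fun i => congrFun this i
  have h1 : n ≤ Module.finrank K (LinearMap.range L) := by
    have := (LinearIndependent.of_comp (LinearMap.range L).subtype
      (v := fun i => (⟨L (v i), ⟨v i, rfl⟩⟩ : LinearMap.range L)) hli).fintype_card_le_finrank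
    simpa using this
  have h2 := LinearMap.finrank_range_add_finrank_ker L
  have h3 := finrank_le_finrank_ker_cross (K := K) f
  rw [Module.finrank_pi_fintype, Finset.sum_const, Finset.card_univ, Fintype.card_fin] at h2
  change _ ≤ Module.finrank K (LinearMap.ker L) at h3
  simp only [smul_eq_mul] at h2
  omega

end Trace

/-! ### Base change of bases and coordinates. -/

section BaseChange

variable {A A' S : Type} [CommRing A] [Algebra ℂ A] [CommRing A'] [Algebra ℂ A']
  [CommRing S] [Algebra ℂ S]

/-- The base change of an ideal of `A ⊗ S` along a homomorphism out of `A`. -/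
abbrev baseIdeal (g : A →ₐ[ℂ] A') (I : Ideal (A ⊗[ℂ] S)) : Ideal (A' ⊗[ℂ] S) :=
  I.map (Algebra.TensorProduct.map g (AlgHom.id ℂ S))

/-- The homomorphism of coordinate rings of families induced by a homomorphism of base rings. -/
def quotMap (g : A →ₐ[ℂ] A') (I : Ideal (A ⊗[ℂ] S)) :
    ((A ⊗[ℂ] S) ⧸ I) →+* ((A' ⊗[ℂ] S) ⧸ baseIdeal g I) :=
  Ideal.quotientMap _ (Algebra.TensorProduct.map g (AlgHom.id ℂ S)).toRingHom Ideal.le_comap_map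

theorem quotMap_mk (g : A →ₐ[ℂ] A') (I : Ideal (A ⊗[ℂ] S)) (t : A ⊗[ℂ] S) :
    quotMap g I (Ideal.Quotient.mk I t) =
      Ideal.Quotient.mk _ (Algebra.TensorProduct.map g (AlgHom.id ℂ S) t) := rfl

theorem quotMap_smul (g : A →ₐ[ℂ] A') (I : Ideal (A ⊗[ℂ] S)) (a : A) (x : (A ⊗[ℂ] S) ⧸ I) :
    quotMap g I (a • x) = g a • quotMap g I x := by
  obtain ⟨t, rfl⟩ := Ideal.Quotient.mk_surjective x
  rw [← Ideal.Quotient.mk_eq_mk, ← Submodule.Quotient.mk_smul, Ideal.Quotient.mk_eq_mk, quotMap_mk,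
    Ideal.Quotient.mk_eq_mk, quotMap_mk, ← Ideal.Quotient.mk_eq_mk, ← Ideal.Quotient.mk_eq_mk,
    ← Submodule.Quotient.mk_smul]
  congr 1
  rw [Algebra.smul_def, map_mul, Algebra.smul_def]
  simp

/-- The coordinates of elements of `A' ⊗ S` in the base change of a basis of a family over `A`. -/
def baseCoord {ι : Type} [Finite ι] (g : A →ₐ[ℂ] A') (I : Ideal (A ⊗[ℂ] S))
    (b : Module.Basis ι A ((A ⊗[ℂ] S) ⧸ I)) : A' ⊗[ℂ] S →ₗ[A'] (ι → A') :=
  TensorProduct.AlgebraTensorModule.lift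
    (LinearMap.toSpanSingleton A' _ (
      { toFun := fun s i => g (b.repr (Ideal.Quotient.mk I (1 ⊗ₜ s)) i)
        map_add' := fun s s' => by
          ext i
          simp [TensorProduct.tmul_add]
        map_smul' := fun c s => by
          ext i
          have : (1 : A) ⊗ₜ[ℂ] (c • s) = algebraMap ℂ A c • ((1 : A) ⊗ₜ[ℂ] s) := by
            rw [TensorProduct.tmul_smul, algebraMap_smul]
          rw [this, ← Ideal.Quotient.mk_eq_mk, Submodule.Quotient.mk_smul, map_smul]
          simp [-algebraMap_smul, Algebra.smul_def] } : S →ₗ[ℂ] (ι → A')))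

variable {ι : Type} [Finite ι] (g : A →ₐ[ℂ] A') (I : Ideal (A ⊗[ℂ] S))
    (b : Module.Basis ι A ((A ⊗[ℂ] S) ⧸ I))

theorem baseCoord_tmul (a : A') (s : S) (i : ι) :
    baseCoord g I b (a ⊗ₜ s) i = a * g (b.repr (Ideal.Quotient.mk I (1 ⊗ₜ s)) i) := by
  simp [baseCoord]

theorem baseCoord_map (t : A ⊗[ℂ] S) (i : ι) :
    baseCoord g I b (Algebra.TensorProduct.map g (AlgHom.id ℂ S) t) i =
      g (b.repr (Ideal.Quotient.mk I t) i) := by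
  induction t with
  | zero => simp
  | add x y hx hy => simp [hx, hy]
  | tmul a s =>
    have : a ⊗ₜ[ℂ] s = a • ((1 : A) ⊗ₜ[ℂ] s) := by rw [TensorProduct.smul_tmul', smul_eq_mul, mul_one]
    conv_rhs => rw [this, ← Ideal.Quotient.mk_eq_mk, Submodule.Quotient.mk_smul]
    simp [baseCoord_tmul]

theorem baseCoord_eq_zero {t : A' ⊗[ℂ] S} (ht : t ∈ baseIdeal g I) : baseCoord g I b t = 0 := by
  suffices ∀ r, baseCoord g I b (r * t) = 0 by simpa using this 1
  refine Submodule.span_induction (p := fun t _ => ∀ r, baseCoord g I b (r * t) = 0) ?_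
    (by simp) (fun x y _ _ hx hy r => ?_) (fun r' x _ hx r => ?_) ht
  · rintro _ ⟨x, hx, rfl⟩ r
    induction r with
    | zero => simp
    | add r r' hr hr' => rw [add_mul, map_add, hr, hr', add_zero]
    | tmul a s =>
      have h : a ⊗ₜ[ℂ] s * Algebra.TensorProduct.map g (AlgHom.id ℂ S) x =
          a • Algebra.TensorProduct.map g (AlgHom.id ℂ S) (((1 : A) ⊗ₜ[ℂ] s) * x) := by
        rw [map_mul, Algebra.TensorProduct.map_tmul, map_one, ← smul_mul_assoc,
          TensorProduct.smul_tmul', smul_eq_mul, mul_one]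
        rfl
      have h0 : Ideal.Quotient.mk I (((1 : A) ⊗ₜ[ℂ] s) * x) = 0 :=
        Ideal.Quotient.eq_zero_iff_mem.2 (I.mul_mem_left _ hx)
      refine (congrArg _ h).trans ?_
      ext i
      rw [map_smul, Pi.smul_apply, baseCoord_map, h0]
      simp
  · rw [mul_add, map_add, hx, hy, add_zero]
  · rw [smul_eq_mul, ← mul_assoc, hx]

/-- Linear independence is the delicate half: the coordinate map `baseCoord` kills the extended
ideal and sends the images of the basis vectors to the standard ones. -/
theorem exists_basis_quotMap :
    ∃ b' : Module.Basis ι A' ((A' ⊗[ℂ] S) ⧸ baseIdeal g I), ∀ i, b' i = quotMap g I (b i) := by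
  have := Fintype.ofFinite ι
  have hli : LinearIndependent A' fun i => quotMap g I (b i) := by
    rw [Fintype.linearIndependent_iff]
    intro c hc i
    choose t ht using fun i => Ideal.Quotient.mk_surjective (b i)
    have h : ∑ i, c i • Algebra.TensorProduct.map g (AlgHom.id ℂ S) (t i) ∈ baseIdeal g I := by
      rw [← Ideal.Quotient.eq_zero_iff_mem, ← hc, map_sum]
      refine Finset.sum_congr rfl fun i _ => ?_
      rw [← ht, quotMap_mk]
      rfl
    have h' := congrFun (baseCoord_eq_zero g I b h) i
    rw [map_sum, Finset.sum_apply] at h'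
    simp only [map_smul, Pi.smul_apply, baseCoord_map, ht, Module.Basis.repr_self] at h'
    rw [Finset.sum_eq_single i (fun j _ hj => by rw [Finsupp.single_eq_of_ne' hj]; simp)
      (by simp)] at h'
    simpa using h'
  refine ⟨Module.Basis.mk hli ?_, Module.Basis.mk_apply _ _⟩
  rintro x -
  obtain ⟨t, rfl⟩ := Ideal.Quotient.mk_surjective x
  induction t with
  | zero => rw [map_zero]; exact zero_mem _
  | add x y hx hy => rw [map_add]; exact add_mem hx hy
  | tmul a s =>
    have h : Ideal.Quotient.mk (baseIdeal g I) (a ⊗ₜ[ℂ] s) =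
        a • quotMap g I (Ideal.Quotient.mk I (1 ⊗ₜ s)) := by
      rw [quotMap_mk, Algebra.TensorProduct.map_tmul, map_one, ← Ideal.Quotient.mk_eq_mk,
        ← Ideal.Quotient.mk_eq_mk, ← Submodule.Quotient.mk_smul, TensorProduct.smul_tmul',
        smul_eq_mul, mul_one]
      rfl
    rw [h, ← b.sum_repr (Ideal.Quotient.mk I (1 ⊗ₜ s)), map_sum]
    refine Submodule.smul_mem _ _ (Submodule.sum_mem _ fun i _ => ?_)
    rw [quotMap_smul]
    exact Submodule.smul_mem _ _ (Submodule.subset_span ⟨i, rfl⟩)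

theorem repr_quotMap (b' : Module.Basis ι A' ((A' ⊗[ℂ] S) ⧸ baseIdeal g I))
    (hb : ∀ i, b' i = quotMap g I (b i)) (x : (A ⊗[ℂ] S) ⧸ I) (i : ι) :
    b'.repr (quotMap g I x) i = g (b.repr x i) := by
  have := Fintype.ofFinite ι
  have h : quotMap g I x = ∑ i, g (b.repr x i) • b' i := by
    conv_lhs => rw [← b.sum_repr x, map_sum]
    simp only [quotMap_smul, hb]
  rw [h, Module.Basis.repr_sum_self]

end BaseChange

/-! ### Openness of the two conditions. -/

section Specialization

variable {R k S : Type} [CommRing R] [IsLocalRing R] [Algebra ℂ R] [Field k] [Algebra ℂ k]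
  [CommRing S] [Algebra ℂ S]

theorem IsAlgFamily.exists_basis {d : ℕ} {I : Ideal (R ⊗[ℂ] S)} (h : IsAlgFamily d I) :
    Nonempty (Module.Basis (Fin d) R ((R ⊗[ℂ] S) ⧸ I)) := by
  have := h.finite
  have := h.flat
  have : Module.Free R ((R ⊗[ℂ] S) ⧸ I) := Module.free_of_flat_of_isLocalRing
  have h' := h.rank (IsLocalRing.closedPoint R)
  rw [Module.rankAtStalk_eq_finrank_of_free] at h'
  exact ⟨Module.finBasisOfFinrankEq R _ h'⟩

/-- The criterion by which all explicit families are recognised: freeness of rank d over the base.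
-/
theorem IsAlgFamily.of_basis {A : Type} [CommRing A] [Algebra ℂ A] [Nontrivial A]
    {d : ℕ} {I : Ideal (A ⊗[ℂ] S)} (b : Module.Basis (Fin d) A ((A ⊗[ℂ] S) ⧸ I)) : IsAlgFamily d I := by
  have : Module.Free A ((A ⊗[ℂ] S) ⧸ I) := .of_basis b
  have : Module.Finite A ((A ⊗[ℂ] S) ⧸ I) := .of_basis b
  refine ⟨inferInstance, inferInstance, ?_, fun p => ?_⟩
  · have : Module.FinitePresentation A ((A ⊗[ℂ] S) ⧸ I) := Module.finitePresentation_of_projective _ _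
    exact Algebra.FinitePresentation.of_finitePresentation _ _
  · rw [Module.rankAtStalk_eq_finrank_of_free, Module.finrank_eq_card_basis b]
    simp

variable (π : R →ₐ[ℂ] ℂ) [IsLocalHom π] (g : R →ₐ[ℂ] k)

-- This is the form in which openness enters: nonvanishing at the closed point makes an element a
-- unit of R, hence nonzero in every field over R.
omit [IsLocalRing R] in
theorem isUnit_map_of_isUnit_map {x : R} (h : IsUnit (π x)) : IsUnit (g x) :=
  ((isUnit_map_iff π x).1 h).map g

theorem traceMatrix_quotMap {A A' : Type} [CommRing A] [Algebra ℂ A] [CommRing A'] [Algebra ℂ A']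
    {d : ℕ} (g : A →ₐ[ℂ] A') {I : Ideal (A ⊗[ℂ] S)}
    (b : Module.Basis (Fin d) A ((A ⊗[ℂ] S) ⧸ I))
    (b' : Module.Basis (Fin d) A' ((A' ⊗[ℂ] S) ⧸ baseIdeal g I))
    (hb : ∀ i, b' i = quotMap g I (b i)) :
    Algebra.traceMatrix A' b' = (Algebra.traceMatrix A b).map g := by
  have htr (x) : Algebra.trace A' _ (quotMap g I x) = g (Algebra.trace A _ x) := by
    rw [Algebra.trace_eq_matrix_trace b, Algebra.trace_eq_matrix_trace b', Matrix.trace,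
      Matrix.trace, map_sum]
    refine Finset.sum_congr rfl fun i _ => ?_
    rw [Matrix.diag_apply, Matrix.diag_apply, Algebra.leftMulMatrix_eq_repr_mul,
      Algebra.leftMulMatrix_eq_repr_mul, hb, ← map_mul, repr_quotMap g I b b' hb]
  ext i j
  rw [Matrix.map_apply, Algebra.traceMatrix_apply, Algebra.traceMatrix_apply,
    Algebra.traceForm_apply, Algebra.traceForm_apply, hb, hb, ← map_mul, htr]

/-- The discriminants of both fibres are images of a single element of R, the determinant of the
trace matrix of a basis of the family. -/
theorem traceForm_nondegenerate_of_specialization {d : ℕ} {I : Ideal (R ⊗[ℂ] S)}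
    (hI : IsAlgFamily d I)
    (h : (Algebra.traceForm ℂ ((ℂ ⊗[ℂ] S) ⧸ baseIdeal π I)).Nondegenerate) :
    (Algebra.traceForm k ((k ⊗[ℂ] S) ⧸ baseIdeal g I)).Nondegenerate := by
  obtain ⟨b⟩ := hI.exists_basis
  obtain ⟨b₁, hb₁⟩ := exists_basis_quotMap π I b
  obtain ⟨b₂, hb₂⟩ := exists_basis_quotMap g I b
  rw [LinearMap.BilinForm.nondegenerate_iff_det_ne_zero b₁, ← Algebra.traceMatrix_of_basis,
    traceMatrix_quotMap π b b₁ hb₁] at h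
  rw [LinearMap.BilinForm.nondegenerate_iff_det_ne_zero b₂, ← Algebra.traceMatrix_of_basis,
    traceMatrix_quotMap g b b₂ hb₂]
  have e (A' : Type) [CommRing A'] [Algebra ℂ A'] (f : R →ₐ[ℂ] A') (M : Matrix (Fin d) (Fin d) R) :
    (M.map f).det = f M.det := (RingHom.map_det f.toRingHom M).symm
  rw [e] at h ⊢
  exact (isUnit_map_of_isUnit_map π g (isUnit_iff_ne_zero.2 h)).ne_zero

/-- The linear forms and the test vectors lift to the free family over R. Both Gram determinants are
then images of one element of R. -/
theorem hasCrossRank_of_specialization {d n : ℕ} {I : Ideal (R ⊗[ℂ] S)} (hI : IsAlgFamily d I)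
    (h : HasCrossRank ℂ ((ℂ ⊗[ℂ] S) ⧸ baseIdeal π I) n) :
    HasCrossRank k ((k ⊗[ℂ] S) ⧸ baseIdeal g I) n := by
  obtain ⟨b⟩ := hI.exists_basis
  obtain ⟨b₁, hb₁⟩ := exists_basis_quotMap π I b
  obtain ⟨b₂, hb₂⟩ := exists_basis_quotMap g I b
  obtain ⟨φ, v, w, hdet⟩ := h
  -- The values on a basis are complex numbers, which lift to R because R is a ℂ-algebra.
  let Φ (i : Fin 3) : ((R ⊗[ℂ] S) ⧸ I) →ₗ[R] R :=
    b.constr R fun j => algebraMap ℂ R (φ i (b₁ j))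
  let Φ' (i : Fin 3) : ((k ⊗[ℂ] S) ⧸ baseIdeal g I) →ₗ[k] k :=
    b₂.constr k fun j => g (algebraMap ℂ R (φ i (b₁ j)))
  have hΦ (i x) : π (Φ i x) = φ i (quotMap π I x) := by
    rw [← b.sum_repr x]
    simp only [Φ, map_sum, map_smul, Module.Basis.constr_basis, quotMap_smul, ← hb₁, smul_eq_mul,
      map_mul, AlgHom.commutes, Algebra.algebraMap_self, RingHom.id_apply]
  have hΦ' (i x) : g (Φ i x) = Φ' i (quotMap g I x) := by
    rw [← b.sum_repr x]
    simp only [Φ, Φ', map_sum, map_smul, Module.Basis.constr_basis, quotMap_smul, ← hb₂,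
      smul_eq_mul, map_mul]
  have hsurj (x : (ℂ ⊗[ℂ] S) ⧸ baseIdeal π I) : ∃ y, quotMap π I y = x := by
    refine ⟨∑ i, algebraMap ℂ R (b₁.repr x i) • b i, ?_⟩
    conv_rhs => rw [← b₁.sum_repr x]
    simp only [map_sum, quotMap_smul, ← hb₁, AlgHom.commutes, Algebra.algebraMap_self,
      RingHom.id_apply]
  choose σ hσ using hsurj
  let V (u : Fin n → Fin 3 → (ℂ ⊗[ℂ] S) ⧸ baseIdeal π I) (i : Fin n) (j : Fin 3) := σ (u i j)
  have hcross {A' : Type} [CommRing A'] [Algebra ℂ A'] (f : R →ₐ[ℂ] A')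
      (ψ : Fin 3 → ((A' ⊗[ℂ] S) ⧸ baseIdeal f I) →ₗ[A'] A')
      (hψ : ∀ i x, f (Φ i x) = ψ i (quotMap f I x)) (a c : Fin 3 → (R ⊗[ℂ] S) ⧸ I) :
      f (crossForm Φ a c) = crossForm ψ (quotMap f I ∘ a) (quotMap f I ∘ c) := by
    unfold crossForm
    rw [map_sum]
    refine Finset.sum_congr rfl fun i _ => ?_
    rw [hψ]
    congr 1
    fin_cases i <;> simp [cross_apply]
  refine ⟨Φ', fun i => quotMap g I ∘ V v i, fun i => quotMap g I ∘ V w i, ?_⟩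
  simp only [← hcross g Φ' hΦ']
  have e (A' : Type) [CommRing A'] [Algebra ℂ A'] (f : R →ₐ[ℂ] A') (M : Fin n → Fin n → R) :
    (Matrix.of fun i j => f (M i j)).det = f (Matrix.of M).det :=
      (RingHom.map_det f.toRingHom (Matrix.of M)).symm
  rw [e]
  refine isUnit_map_of_isUnit_map π g ?_
  rw [← e]
  simp only [hcross π φ hΦ]
  convert hdet using 6 <;> (ext i; exact hσ _)

end Specialization

/-! ### Algebras with Hilbert function (1, 4, 3) and arbitrary quadratic relations. -/

section QuadricAlgebra

variable {A : Type} [CommRing A]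

/-- The algebra with basis `1, x, y, z, w, xy, yz, zw` in which the products of `x, y, z, w` of
degree three vanish and the rows of `q` are the coordinates of
`x², y², z², w², xz, yw, xw` in the basis `xy, yz, zw`. -/
@[ext]
structure QuadricAlgebra (q : Fin 7 → Fin 3 → A) where
  /-- the constant coordinate -/
  c : A
  /-- the coordinates in degree one -/
  l : Fin 4 → A
  /-- the coordinates in degree two -/
  s : Fin 3 → A

namespace QuadricAlgebra

variable {q : Fin 7 → Fin 3 → A}

/-- The product of two linear forms. -/
def prodForm (q : Fin 7 → Fin 3 → A) (u v : Fin 4 → A) (k : Fin 3) : A :=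
  q 0 k * (u 0 * v 0) + q 1 k * (u 1 * v 1) + q 2 k * (u 2 * v 2) + q 3 k * (u 3 * v 3) +
    q 4 k * (u 0 * v 2 + u 2 * v 0) + q 5 k * (u 1 * v 3 + u 3 * v 1) +
    q 6 k * (u 0 * v 3 + u 3 * v 0) +
    ![u 0 * v 1 + u 1 * v 0, u 1 * v 2 + u 2 * v 1, u 2 * v 3 + u 3 * v 2] k

theorem prodForm_comm (u v : Fin 4 → A) : prodForm q u v = prodForm q v u := by
  ext k; fin_cases k <;> simp [prodForm] <;> ring

theorem prodForm_smul_left (a : A) (u v : Fin 4 → A) :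
    prodForm q (a • u) v = a • prodForm q u v := by
  ext k; fin_cases k <;> simp [prodForm] <;> ring

theorem prodForm_smul_right (a : A) (u v : Fin 4 → A) :
    prodForm q u (a • v) = a • prodForm q u v := by
  rw [prodForm_comm, prodForm_smul_left, prodForm_comm]

theorem prodForm_add_left (u u' v : Fin 4 → A) :
    prodForm q (u + u') v = prodForm q u v + prodForm q u' v := by
  ext k; fin_cases k <;> simp [prodForm] <;> ring

theorem prodForm_add_right (u v v' : Fin 4 → A) :
    prodForm q u (v + v') = prodForm q u v + prodForm q u v' := by
  rw [prodForm_comm, prodForm_add_left, prodForm_comm, prodForm_comm v']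

theorem prodForm_zero_left (v : Fin 4 → A) : prodForm q 0 v = 0 := by
  simpa using prodForm_smul_left (q := q) 0 0 v

theorem prodForm_zero_right (v : Fin 4 → A) : prodForm q v 0 = 0 := by
  rw [prodForm_comm, prodForm_zero_left]

instance : Zero (QuadricAlgebra q) := ⟨⟨0, 0, 0⟩⟩
instance : One (QuadricAlgebra q) := ⟨⟨1, 0, 0⟩⟩
instance : Add (QuadricAlgebra q) := ⟨fun x y => ⟨x.c + y.c, x.l + y.l, x.s + y.s⟩⟩
instance : Neg (QuadricAlgebra q) := ⟨fun x => ⟨-x.c, -x.l, -x.s⟩⟩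
instance : Mul (QuadricAlgebra q) := ⟨fun x y => ⟨x.c * y.c, x.c • y.l + y.c • x.l,
  x.c • y.s + y.c • x.s + prodForm q x.l y.l⟩⟩

@[simp] theorem zero_c : (0 : QuadricAlgebra q).c = 0 := rfl
@[simp] theorem zero_l : (0 : QuadricAlgebra q).l = 0 := rfl
@[simp] theorem zero_s : (0 : QuadricAlgebra q).s = 0 := rfl
@[simp] theorem one_c : (1 : QuadricAlgebra q).c = 1 := rfl
@[simp] theorem one_l : (1 : QuadricAlgebra q).l = 0 := rfl
@[simp] theorem one_s : (1 : QuadricAlgebra q).s = 0 := rfl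
@[simp] theorem neg_c (x : QuadricAlgebra q) : (-x).c = -x.c := rfl
@[simp] theorem neg_l (x : QuadricAlgebra q) : (-x).l = -x.l := rfl
@[simp] theorem neg_s (x : QuadricAlgebra q) : (-x).s = -x.s := rfl
@[simp] theorem add_c (x y : QuadricAlgebra q) : (x + y).c = x.c + y.c := rfl
@[simp] theorem add_l (x y : QuadricAlgebra q) : (x + y).l = x.l + y.l := rfl
@[simp] theorem add_s (x y : QuadricAlgebra q) : (x + y).s = x.s + y.s := rfl
@[simp] theorem mul_c (x y : QuadricAlgebra q) : (x * y).c = x.c * y.c := rfl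
@[simp] theorem mul_l (x y : QuadricAlgebra q) : (x * y).l = x.c • y.l + y.c • x.l := rfl
@[simp] theorem mul_s (x y : QuadricAlgebra q) :
    (x * y).s = x.c • y.s + y.c • x.s + prodForm q x.l y.l := rfl

/-- Associativity imposes no condition on `q`, since the product of three linear forms is zero
however it is bracketed. -/
instance : CommRing (QuadricAlgebra q) where
  add_assoc _ _ _ := by ext1 <;> simp [add_assoc]
  zero_add _ := by ext1 <;> simp
  add_zero _ := by ext1 <;> simp
  nsmul := nsmulRec
  zsmul := zsmulRec
  add_comm _ _ := by ext1 <;> simp [add_comm]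
  neg_add_cancel _ := by ext1 <;> simp
  left_distrib x y z := by
    ext1
    · simp [mul_add]
    · simp only [mul_l, add_l, add_c]; module
    · simp only [mul_s, add_l, add_c, add_s, prodForm_add_right]; module
  right_distrib x y z := by
    ext1
    · simp [add_mul]
    · simp only [mul_l, add_l, add_c]; module
    · simp only [mul_s, add_l, add_c, add_s, prodForm_add_left]; module
  zero_mul _ := by ext1 <;> simp [prodForm_zero_left]
  mul_zero _ := by ext1 <;> simp [prodForm_zero_right]
  mul_assoc x y z := by
    ext1
    · simp [mul_assoc]
    · simp only [mul_l, mul_c]; module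
    · simp only [mul_s, mul_l, mul_c, prodForm_add_left, prodForm_add_right, prodForm_smul_left,
        prodForm_smul_right]
      module
  one_mul _ := by ext1 <;> simp [prodForm_zero_left]
  mul_one _ := by ext1 <;> simp [prodForm_zero_right]
  mul_comm x y := by
    ext1
    · simp [mul_comm]
    · simp only [mul_l]; module
    · simp only [mul_s, prodForm_comm x.l]; module

/-- The inclusion of the constants. -/
def ofConst : A →+* QuadricAlgebra q where
  toFun a := ⟨a, 0, 0⟩
  map_one' := rfl
  map_zero' := rfl
  map_mul' a b := by ext1 <;> simp [prodForm_zero_left]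
  map_add' a b := by ext1 <;> simp

instance {R : Type} [CommRing R] [Algebra R A] : Algebra R (QuadricAlgebra q) :=
  ((ofConst (q := q)).comp (algebraMap R A)).toAlgebra

theorem algebraMap_eq {R : Type} [CommRing R] [Algebra R A] (a : R) :
    algebraMap R (QuadricAlgebra q) a = ⟨algebraMap R A a, 0, 0⟩ := rfl

instance {R : Type} [CommRing R] [Algebra R A] : IsScalarTower R A (QuadricAlgebra q) :=
  .of_algebraMap_eq fun _ => rfl

@[simp] theorem smul_c (a : A) (x : QuadricAlgebra q) : (a • x).c = a * x.c := by
  rw [Algebra.smul_def]; rfl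
@[simp] theorem smul_l (a : A) (x : QuadricAlgebra q) : (a • x).l = a • x.l := by
  rw [Algebra.smul_def, mul_l, algebraMap_eq]; simp
@[simp] theorem smul_s (a : A) (x : QuadricAlgebra q) : (a • x).s = a • x.s := by
  rw [Algebra.smul_def, mul_s, algebraMap_eq]; simp [prodForm_zero_left]

/-- The coordinates of an element. -/
def coord : QuadricAlgebra q ≃ₗ[A] (Fin 8 → A) where
  toFun x := ![x.c, x.l 0, x.l 1, x.l 2, x.l 3, x.s 0, x.s 1, x.s 2]
  invFun v := ⟨v 0, ![v 1, v 2, v 3, v 4], ![v 5, v 6, v 7]⟩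
  map_add' x y := by ext i; fin_cases i <;> simp
  map_smul' a x := by ext i; fin_cases i <;> simp
  left_inv x := by
    ext i
    · rfl
    · fin_cases i <;> rfl
    · fin_cases i <;> rfl
  right_inv v := by ext i; fin_cases i <;> rfl

/-- The basis `1, x, y, z, w, xy, yz, zw`. -/
def basis : Module.Basis (Fin 8) A (QuadricAlgebra q) := .ofEquivFun coord

/-- The generators `x, y, z, w`. -/
def gen (i : Fin 4) : QuadricAlgebra q := ⟨0, Pi.single i 1, 0⟩

end QuadricAlgebra
end QuadricAlgebra

namespace QuadricAlgebra

/-- The structure constants of the algebra `ℂ[x, y, z, w] ⧸ pointIdeal`. -/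
def baseForm (A : Type) [CommRing A] : Fin 7 → Fin 3 → A := Pi.single 6 (Pi.single 1 1)

theorem prodForm_baseForm {A : Type} [CommRing A] (u v : Fin 4 → A) :
    prodForm (baseForm A) u v = ![u 0 * v 1 + u 1 * v 0,
      u 0 * v 3 + u 3 * v 0 + (u 1 * v 2 + u 2 * v 1), u 2 * v 3 + u 3 * v 2] := by
  ext k
  fin_cases k <;> simp [prodForm, baseForm]

/-! ### Quadric algebras as quotients of the polynomial ring. -/

section Evaluation

variable {A : Type} [CommRing A] [Algebra ℂ A] {q : Fin 7 → Fin 3 → A}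

/-- The homomorphism `x_i ↦ t_i + x_i`. -/
def evalPoly (q : Fin 7 → Fin 3 → A) (t : Fin 4 → A) : Poly4 →ₐ[ℂ] QuadricAlgebra q :=
  MvPolynomial.aeval fun i => algebraMap A _ (t i) + gen i

/-- The homomorphism from the polynomial ring over `A` that maps `x_i` to `t_i + x_i`. -/
def eval (q : Fin 7 → Fin 3 → A) (t : Fin 4 → A) : A ⊗[ℂ] Poly4 →ₐ[A] QuadricAlgebra q :=
  Algebra.TensorProduct.lift (Algebra.ofId A _) (evalPoly q t) fun _ _ => Commute.all _ _

theorem eval_tmul (t : Fin 4 → A) (a : A) (p : Poly4) :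
    eval q t (a ⊗ₜ p) = a • evalPoly q t p := by
  rw [eval, Algebra.TensorProduct.lift_tmul, Algebra.smul_def]
  rfl

theorem evalPoly_X (t : Fin 4 → A) (i : Fin 4) :
    evalPoly q t (MvPolynomial.X i) = ⟨t i, Pi.single i 1, 0⟩ := by
  rw [evalPoly, MvPolynomial.aeval_X, algebraMap_eq, gen]
  ext1 <;> simp

theorem eval_surjective (t : Fin 4 → A) : Function.Surjective (eval q t) := by
  have hgen (i) : (gen i : QuadricAlgebra q) ∈ (eval q t).range := by
    have : (gen i : QuadricAlgebra q) =
        eval q t (1 ⊗ₜ MvPolynomial.X i) - algebraMap A _ (t i) := by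
      rw [eval_tmul, evalPoly, MvPolynomial.aeval_X, one_smul]
      ring
    rw [this]
    exact sub_mem ⟨_, rfl⟩ (Subalgebra.algebraMap_mem _ _)
  intro x
  -- The degree two basis vectors are the products xy, yz, zw whatever `q` is, so the four
  -- generators suffice.
  have hx : x = algebraMap A _ x.c + (x.l 0 • gen 0 + x.l 1 • gen 1 + x.l 2 • gen 2 +
      x.l 3 • gen 3) + (x.s 0 • (gen 0 * gen 1) + x.s 1 • (gen 1 * gen 2) +
      x.s 2 • (gen 2 * gen 3)) := by
    ext k
    · simp [algebraMap_eq, gen]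
    · fin_cases k <;> simp [algebraMap_eq, gen]
    · fin_cases k <;> simp [algebraMap_eq, gen, prodForm]
  rw [← AlgHom.mem_range, hx]
  refine add_mem (add_mem (Subalgebra.algebraMap_mem _ _) ?_) ?_
  · exact add_mem (add_mem (add_mem (Subalgebra.smul_mem _ (hgen _) _)
      (Subalgebra.smul_mem _ (hgen _) _)) (Subalgebra.smul_mem _ (hgen _) _))
      (Subalgebra.smul_mem _ (hgen _) _)
  · exact add_mem (add_mem (Subalgebra.smul_mem _ (mul_mem (hgen _) (hgen _)) _)
      (Subalgebra.smul_mem _ (mul_mem (hgen _) (hgen _)) _))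
      (Subalgebra.smul_mem _ (mul_mem (hgen _) (hgen _)) _)

/-- The coordinate ring of the family of quadric algebras. -/
def quotEquiv (q : Fin 7 → Fin 3 → A) (t : Fin 4 → A) :
    ((A ⊗[ℂ] Poly4) ⧸ RingHom.ker (eval q t)) ≃ₐ[A] QuadricAlgebra q :=
  Ideal.quotientKerAlgEquivOfSurjective (eval_surjective t)

theorem isAlgFamily_ker_eval [Nontrivial A] (q : Fin 7 → Fin 3 → A) (t : Fin 4 → A) :
    IsAlgFamily 8 (RingHom.ker (eval q t)) :=
  .of_basis (basis.map (quotEquiv q t).symm.toLinearEquiv)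

end Evaluation

/-! ### The alternating form of Z has rank at least 18. -/

section CrossRank

/-- The `k`-th coordinate in degree two. -/
def coordTop (k : Fin 3) : QuadricAlgebra (baseForm ℂ) →ₗ[ℂ] ℂ where
  toFun x := x.s k
  map_add' _ _ := rfl
  map_smul' a x := by simp

/-- The coordinates of degree two of a product, in integral coordinates. -/
def topCoeff (x y : Fin 8 → ℤ) : Fin 3 → ℤ :=
  ![x 0 * y 5 + y 0 * x 5 + (x 1 * y 2 + x 2 * y 1),
    x 0 * y 6 + y 0 * x 6 + (x 1 * y 4 + x 4 * y 1 + (x 2 * y 3 + x 3 * y 2)),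
    x 0 * y 7 + y 0 * x 7 + (x 3 * y 4 + x 4 * y 3)]

/-- The form `crossForm coordTop` in integral coordinates. -/
def intCrossForm (u v : Fin 3 → Fin 8 → ℤ) : ℤ :=
  topCoeff (u 1) (v 2) 0 - topCoeff (u 2) (v 1) 0 + (topCoeff (u 2) (v 0) 1 -
    topCoeff (u 0) (v 2) 1) + (topCoeff (u 0) (v 1) 2 - topCoeff (u 1) (v 0) 2)

/-- The element with given integral coordinates. -/
def ofInt (x : Fin 8 → ℤ) : QuadricAlgebra (baseForm ℂ) := coord.symm fun i => (x i : ℂ)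

theorem mul_ofInt_s (x y : Fin 8 → ℤ) (k : Fin 3) :
    (ofInt x * ofInt y).s k = (topCoeff x y k : ℤ) := by
  rw [mul_s, prodForm_baseForm]
  fin_cases k <;> simp [ofInt, topCoeff, coord]

theorem sub_s {A : Type} [CommRing A] {q : Fin 7 → Fin 3 → A} (x y : QuadricAlgebra q) :
    (x - y).s = x.s - y.s := by
  rw [sub_eq_add_neg, sub_eq_add_neg]; rfl

theorem crossForm_ofInt (u v : Fin 3 → Fin 8 → ℤ) :
    crossForm coordTop (fun i => ofInt (u i)) (fun i => ofInt (v i)) = (intCrossForm u v : ℤ) := by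
  simp [crossForm, Fin.sum_univ_three, coordTop, cross_apply, sub_s, mul_ofInt_s,
    intCrossForm, -mul_s]

/-- The coordinate vectors of `(ℤ⁸)³`. -/
def unitVec (j : Fin 3) (a : Fin 8) : Fin 3 → Fin 8 → ℤ := fun j' a' => if j = j' ∧ a = a' then 1 else 0

/-- Vectors spanning a complement of the radical of `intCrossForm`. -/
def leftVec : Fin 18 → Fin 3 → Fin 8 → ℤ :=
  ![unitVec 0 0, unitVec 1 0, unitVec 2 0, unitVec 1 7, unitVec 2 5, unitVec 0 6,
    unitVec 0 1, unitVec 0 2, unitVec 0 3, unitVec 0 4,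
    unitVec 1 1, unitVec 1 2, unitVec 1 3, unitVec 1 4,
    unitVec 2 1, unitVec 2 2, unitVec 2 3, unitVec 2 4]

/-- Vectors dual to `leftVec`. -/
def rightVec : Fin 18 → Fin 3 → Fin 8 → ℤ :=
  ![unitVec 1 7, unitVec 2 5, unitVec 0 6, -unitVec 0 0, -unitVec 1 0, -unitVec 2 0,
    -unitVec 2 4, -unitVec 2 3, unitVec 1 4, unitVec 1 3,
    unitVec 1 4 + unitVec 2 2, unitVec 1 3 + unitVec 2 1, -unitVec 0 4 - unitVec 1 2,
    -unitVec 0 3 - unitVec 1 1,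
    -unitVec 1 2, -unitVec 1 1, unitVec 0 2, unitVec 0 1]

-- For the three degree two coordinate forms, constants pair with degree two elements in a block of
-- rank 3 + 3, and linear forms pair among themselves in a block of rank 12. The remaining 24 - 18 =
-- 6 dimensions of degree two lie in the radical.
set_option maxRecDepth 100000 in
theorem intCrossForm_leftVec_rightVec :
    ∀ i j, intCrossForm (leftVec i) (rightVec j) = if i = j then 1 else 0 := by
  decide +kernel

theorem hasCrossRank : HasCrossRank ℂ (QuadricAlgebra (baseForm ℂ)) 18 := by
  refine ⟨coordTop, fun i j => ofInt (leftVec i j), fun i j => ofInt (rightVec i j), ?_⟩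
  have : (Matrix.of fun i j => crossForm coordTop (fun k => ofInt (leftVec i k))
      (fun k => ofInt (rightVec j k))) = 1 := by
    ext i j
    rw [Matrix.of_apply, crossForm_ofInt, intCrossForm_leftVec_rightVec, Matrix.one_apply]
    split_ifs <;> simp
  rw [this]
  simp

end CrossRank

/-! ### The coordinate ring of Z. -/

section Point

open MvPolynomial

/-- The polynomial with given coordinates. -/
def toPoly (x : QuadricAlgebra (baseForm ℂ)) : Poly4 :=
  C x.c + (C (x.l 0) * X 0 + C (x.l 1) * X 1 + C (x.l 2) * X 2 + C (x.l 3) * X 3) +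
    (C (x.s 0) * (X 0 * X 1) + C (x.s 1) * (X 1 * X 2) + C (x.s 2) * (X 2 * X 3))

/-- One step of reduction to normal form: multiplying a normal form by a variable and renormalising
changes it only by relations of the ideal. The coefficients used below record which relations are
applied. -/
theorem toPoly_mul_X_sub_mem (x : QuadricAlgebra (baseForm ℂ)) (i : Fin 4) :
    toPoly x * X i - toPoly (x * gen i) ∈ pointIdeal := by
  rw [← Ideal.Quotient.eq]
  have hmem (f : Poly4) (hf : f ∈ ({X 0 ^ 2, X 1 ^ 2, X 2 ^ 2, X 3 ^ 2, X 0 * X 2, X 1 * X 3,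
    X 0 * X 3 - X 1 * X 2} : Set Poly4)) : Ideal.Quotient.mk pointIdeal f = 0 :=
    Ideal.Quotient.eq_zero_iff_mem.2 (Ideal.subset_span hf)
  have h0 := hmem (X 0 ^ 2) (by simp)
  have h1 := hmem (X 1 ^ 2) (by simp)
  have h2 := hmem (X 2 ^ 2) (by simp)
  have h3 := hmem (X 3 ^ 2) (by simp)
  have h4 := hmem (X 0 * X 2) (by simp)
  have h5 := hmem (X 1 * X 3) (by simp)
  have h6 := hmem (X 0 * X 3 - X 1 * X 2) (by simp)
  simp only [map_mul, map_pow, map_sub] at h0 h1 h2 h3 h4 h5 h6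
  simp only [toPoly, map_add, map_mul, mul_c, mul_l, mul_s, prodForm_baseForm]
  let x0 : Poly4 ⧸ pointIdeal := Ideal.Quotient.mk pointIdeal (X 0)
  let x1 : Poly4 ⧸ pointIdeal := Ideal.Quotient.mk pointIdeal (X 1)
  let x2 : Poly4 ⧸ pointIdeal := Ideal.Quotient.mk pointIdeal (X 2)
  let x3 : Poly4 ⧸ pointIdeal := Ideal.Quotient.mk pointIdeal (X 3)
  let c (a : ℂ) : Poly4 ⧸ pointIdeal := Ideal.Quotient.mk pointIdeal (C a)
  fin_cases i <;> simp [gen]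
  · linear_combination c (x.l 0) * h0 + c (x.l 2) * h4 + c (x.l 3) * h6 + c (x.s 0) * x1 * h0 +
      c (x.s 1) * x1 * h4 + c (x.s 2) * x3 * h4
  · linear_combination c (x.l 1) * h1 + c (x.l 3) * h5 + c (x.s 0) * x0 * h1 +
      c (x.s 1) * x2 * h1 + c (x.s 2) * x2 * h5
  · linear_combination c (x.l 0) * h4 + c (x.l 2) * h2 + c (x.s 0) * x1 * h4 +
      c (x.s 1) * x1 * h2 + c (x.s 2) * x3 * h2
  · linear_combination c (x.l 0) * h6 + c (x.l 1) * h5 + c (x.l 3) * h3 + c (x.s 0) * x0 * h5 +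
      c (x.s 1) * x2 * h5 + c (x.s 2) * x2 * h3

theorem sub_toPoly_mem (p : Poly4) : p - toPoly (evalPoly (baseForm ℂ) 0 p) ∈ pointIdeal := by
  induction p using MvPolynomial.induction_on with
  | C a =>
    have : evalPoly (baseForm ℂ) 0 (C a) = ⟨a, 0, 0⟩ := AlgHom.commutes _ _
    rw [this]
    simp [toPoly]
  | add p r hp hr =>
    have : toPoly (evalPoly (baseForm ℂ) 0 (p + r)) =
        toPoly (evalPoly (baseForm ℂ) 0 p) + toPoly (evalPoly (baseForm ℂ) 0 r) := by
      simp [toPoly]; ring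
    rw [this]
    convert add_mem hp hr using 1
    ring
  | mul_X p i hp =>
    have h : evalPoly (baseForm ℂ) 0 (p * X i) = evalPoly (baseForm ℂ) 0 p * gen i := by
      rw [map_mul, evalPoly_X]; rfl
    rw [h]
    convert add_mem (Ideal.mul_mem_right (X i) _ hp)
      (toPoly_mul_X_sub_mem (evalPoly (baseForm ℂ) 0 p) i) using 1
    ring

/-- A polynomial agrees with its normal form modulo the ideal, so one that evaluates to zero lies in
the ideal; the generators evaluate to zero by direct computation. -/
theorem ker_evalPoly : RingHom.ker (evalPoly (baseForm ℂ) 0) = pointIdeal := by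
  apply le_antisymm
  · intro p hp
    have := sub_toPoly_mem p
    rw [RingHom.mem_ker.1 hp] at this
    simpa [toPoly] using this
  · rw [pointIdeal, Ideal.span_le]
    rintro p hp
    simp only [Set.mem_insert_iff, Set.mem_singleton_iff] at hp
    rcases hp with rfl | rfl | rfl | rfl | rfl | rfl | rfl <;>
    · rw [SetLike.mem_coe, RingHom.mem_ker]
      try simp only [pow_two, sub_eq_add_neg]
      simp only [map_add, map_neg, map_mul, evalPoly_X]
      ext k
      · simp
      · simp
      · fin_cases k <;> simp [prodForm_baseForm]

end Point
end QuadricAlgebra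

/-! ### Subschemes over ℂ given by surjections, and the trace form of `ℂⁿ`. -/

section SpecialFiber

variable {S C : Type} [CommRing S] [Algebra ℂ S] [CommRing C] [Algebra ℂ C]

theorem map_includeRight_eq_ker (ψ : S →ₐ[ℂ] C) :
    (RingHom.ker ψ).map (Algebra.TensorProduct.includeRight : S →ₐ[ℂ] ℂ ⊗[ℂ] S) =
      RingHom.ker (ψ.comp (Algebra.TensorProduct.lid ℂ S).toAlgHom) := by
  apply le_antisymm
  · rw [Ideal.map_le_iff_le_comap]
    intro s hs
    rw [RingHom.mem_ker] at hs
    simpa [RingHom.mem_ker] using hs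
  · intro t ht
    have h : t = Algebra.TensorProduct.includeRight (Algebra.TensorProduct.lid ℂ S t) :=
      ((Algebra.TensorProduct.lid ℂ S).symm_apply_apply t).symm
    rw [h]
    exact Ideal.mem_map_of_mem _ ht

/-- The coordinate ring of the closed subscheme given by the kernel of a surjection. -/
def specialFiberEquiv (ψ : S →ₐ[ℂ] C) (hψ : Function.Surjective ψ) :
    ((ℂ ⊗[ℂ] S) ⧸ (RingHom.ker ψ).map (Algebra.TensorProduct.includeRight : S →ₐ[ℂ] ℂ ⊗[ℂ] S))
      ≃ₐ[ℂ] C :=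
  (Ideal.quotientEquivAlgOfEq ℂ (map_includeRight_eq_ker ψ)).trans
    (Ideal.quotientKerAlgEquivOfSurjective
      (f := ψ.comp (Algebra.TensorProduct.lid ℂ S).toAlgHom)
      (hψ.comp (Algebra.TensorProduct.lid ℂ S).surjective))

theorem isAlgFamily_specialFiber (ψ : S →ₐ[ℂ] C) (hψ : Function.Surjective ψ) {d : ℕ}
    (b : Module.Basis (Fin d) ℂ C) :
    IsAlgFamily d ((RingHom.ker ψ).map
      (Algebra.TensorProduct.includeRight : S →ₐ[ℂ] ℂ ⊗[ℂ] S)) :=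
  .of_basis (b.map (specialFiberEquiv ψ hψ).symm.toLinearEquiv)

theorem traceForm_nondegenerate_of_algEquiv {K C D : Type*} [Field K] [CommRing C] [Algebra K C]
    [CommRing D] [Algebra K D] (e : C ≃ₐ[K] D) (h : (Algebra.traceForm K C).Nondegenerate) :
    (Algebra.traceForm K D).Nondegenerate := by
  have key (x y : D) : Algebra.traceForm K D x y = Algebra.traceForm K C (e.symm x) (e.symm y) := by
    rw [Algebra.traceForm_apply, Algebra.traceForm_apply, ← map_mul,
      Algebra.trace_eq_of_algEquiv e.symm]
  refine ⟨fun x hx => ?_, fun x hx => ?_⟩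
  · rw [← map_eq_zero_iff e.symm e.symm.injective]
    exact h.1 _ fun y => by simpa [key] using hx (e y)
  · rw [← map_eq_zero_iff e.symm e.symm.injective]
    exact h.2 _ fun y => by simpa [key] using hx (e y)

theorem traceForm_pi_nondegenerate (n : ℕ) :
    (Algebra.traceForm ℂ (Fin n → ℂ)).Nondegenerate := by
  have htr (x : Fin n → ℂ) : Algebra.trace ℂ (Fin n → ℂ) x = ∑ i, x i := by
    rw [Algebra.trace_eq_matrix_trace (Pi.basisFun ℂ (Fin n)), Matrix.trace]
    refine Finset.sum_congr rfl fun i _ => ?_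
    rw [Matrix.diag_apply, Algebra.leftMulMatrix_eq_repr_mul]
    simp
  have key (x : Fin n → ℂ) (i : Fin n) :
      Algebra.traceForm ℂ (Fin n → ℂ) x (Pi.single i 1) = x i := by
    rw [Algebra.traceForm_apply, htr]
    simp [Pi.single_apply]
  refine ⟨fun x hx => funext fun i => ?_, fun x hx => funext fun i => ?_⟩
  · exact (key x i).symm.trans (hx _)
  · rw [Pi.zero_apply, ← key x i, Algebra.traceForm_apply, mul_comm]
    exact hx _

end SpecialFiber

/-! ### Z and eight distinct points on the cone. -/

open MvPolynomial

theorem coneIdeal_le_pointIdeal : coneIdeal ≤ pointIdeal := by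
  have h (f : Poly4) (hf : f ∈ ({X 0 ^ 2, X 1 ^ 2, X 2 ^ 2, X 3 ^ 2, X 0 * X 2, X 1 * X 3,
    X 0 * X 3 - X 1 * X 2} : Set Poly4)) : f ∈ pointIdeal := Ideal.subset_span hf
  rw [coneIdeal, Ideal.span_le]
  rintro f hf
  simp only [Set.mem_insert_iff, Set.mem_singleton_iff] at hf
  rcases hf with rfl | rfl | rfl
  · exact sub_mem (h _ (by simp)) (h _ (by simp))
  · exact h _ (by simp)
  · exact sub_mem (h _ (by simp)) (h _ (by simp))

theorem evalPoly_surjective :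
    Function.Surjective (QuadricAlgebra.evalPoly (QuadricAlgebra.baseForm ℂ) 0) := by
  intro x
  obtain ⟨t, ht⟩ := QuadricAlgebra.eval_surjective (q := QuadricAlgebra.baseForm ℂ) 0 x
  refine ⟨Algebra.TensorProduct.lid ℂ _ t, ?_⟩
  have h : t = (1 : ℂ) ⊗ₜ[ℂ] (Algebra.TensorProduct.lid ℂ _ t) :=
      ((Algebra.TensorProduct.lid ℂ _).symm_apply_apply t).symm
  rw [h, QuadricAlgebra.eval_tmul, one_smul] at ht
  exact ht

theorem finrank_quotient_pointIdeal : Module.finrank ℂ (Poly4 ⧸ pointIdeal) = 8 := by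
  let e := (Ideal.quotientEquivAlgOfEq ℂ QuadricAlgebra.ker_evalPoly).symm.trans
    (Ideal.quotientKerAlgEquivOfSurjective evalPoly_surjective)
  rw [e.toLinearEquiv.finrank_eq, Module.finrank_eq_card_basis QuadricAlgebra.basis,
    Fintype.card_fin]

/-- The coordinate ring of `Z`, as a quotient of the coordinate ring of the twisted cone. -/
def evalCone : (Poly4 ⧸ coneIdeal) →ₐ[ℂ] QuadricAlgebra (QuadricAlgebra.baseForm ℂ) :=
  Ideal.Quotient.liftₐ coneIdeal (QuadricAlgebra.evalPoly (QuadricAlgebra.baseForm ℂ) 0)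
    fun a ha => by
      rw [← RingHom.mem_ker, QuadricAlgebra.ker_evalPoly]
      exact coneIdeal_le_pointIdeal ha

theorem evalCone_surjective : Function.Surjective evalCone := by
  intro x
  obtain ⟨p, rfl⟩ := evalPoly_surjective x
  exact ⟨Ideal.Quotient.mk _ p, rfl⟩

theorem ker_evalCone :
    RingHom.ker evalCone = pointIdeal.map (Ideal.Quotient.mk coneIdeal) := by
  rw [← QuadricAlgebra.ker_evalPoly]
  exact Ideal.ker_quotient_lift _ _

/-- Evaluation at the eight points `(1, t, t², t³)`, `t = 0, …, 7`, of the twisted cone. -/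
def evalPoints : (Poly4 ⧸ coneIdeal) →ₐ[ℂ] (Fin 8 → ℂ) :=
  -- At t = 0 the first coordinate is 0 ^ 0 = 1, as required.
  Ideal.Quotient.liftₐ coneIdeal (aeval fun i t => ((t : ℕ) : ℂ) ^ (i : ℕ)) fun a ha => by
    have : coneIdeal ≤ RingHom.ker
        (aeval (R := ℂ) fun (i : Fin 4) (t : Fin 8) => ((t : ℕ) : ℂ) ^ (i : ℕ)) := by
      rw [coneIdeal, Ideal.span_le]
      rintro f hf
      simp only [Set.mem_insert_iff, Set.mem_singleton_iff] at hf
      rcases hf with rfl | rfl | rfl <;>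
      · rw [SetLike.mem_coe, RingHom.mem_ker]
        ext t
        simp
        try ring
    exact this ha

theorem evalPoints_surjective : Function.Surjective evalPoints := by
  intro v
  -- The coordinate y takes the distinct values t at the eight points, so polynomials in y alone
  -- interpolate any values.
  let p := Lagrange.interpolate Finset.univ (fun t : Fin 8 => ((t : ℕ) : ℂ)) v
  refine ⟨Ideal.Quotient.mk _ (Polynomial.aeval (X 1) p), ?_⟩
  change aeval (fun (i : Fin 4) (t : Fin 8) => ((t : ℕ) : ℂ) ^ (i : ℕ))
    (Polynomial.aeval (X 1) p) = v
  rw [← Polynomial.aeval_algHom_apply, aeval_X]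
  ext t
  rw [Polynomial.aeval_pi_apply₂]
  simp only [Fin.val_one, pow_one, Polynomial.coe_aeval_eq_eval]
  exact Lagrange.eval_interpolate_at_node _ (fun a _ b _ h => Fin.ext (Nat.cast_injective h))
    (Finset.mem_univ t)

theorem isAlgFamily_pointIdeal :
    IsAlgFamily 8 (pointIdeal.map (Algebra.TensorProduct.includeRight :
      Poly4 →ₐ[ℂ] ℂ ⊗[ℂ] Poly4)) := by
  rw [← QuadricAlgebra.ker_evalPoly]
  exact isAlgFamily_specialFiber _ evalPoly_surjective QuadricAlgebra.basis

theorem isAlgFamily_pointIdeal_cone :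
    IsAlgFamily 8 ((pointIdeal.map (Ideal.Quotient.mk coneIdeal)).map
      (Algebra.TensorProduct.includeRight : (Poly4 ⧸ coneIdeal) →ₐ[ℂ] ℂ ⊗[ℂ] _)) := by
  rw [← ker_evalCone]
  exact isAlgFamily_specialFiber _ evalCone_surjective QuadricAlgebra.basis

/-! ### The Hilbert scheme of the cone is not irreducible. -/

section Reducible

variable {S : Type} [CommRing S] [Algebra ℂ S] {d : ℕ} {H : SchC}

/-- Two points of an irreducible Hilbert scheme are specializations of a common family over a
field. -/
theorem exists_common_generization [IrreducibleSpace H.left]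
    (r : (hilbFunctor (specC S) d).RepresentableBy H) (f₁ f₂ : specC ℂ ⟶ H) :
    ∃ (k R₁ R₂ : Type) (_ : Field k) (_ : Algebra ℂ k)
      (_ : CommRing R₁) (_ : IsLocalRing R₁) (_ : Algebra ℂ R₁)
      (_ : CommRing R₂) (_ : IsLocalRing R₂) (_ : Algebra ℂ R₂)
      (I₁ : Ideal (R₁ ⊗[ℂ] S)) (I₂ : Ideal (R₂ ⊗[ℂ] S))
      (π₁ : R₁ →ₐ[ℂ] ℂ) (π₂ : R₂ →ₐ[ℂ] ℂ) (g₁ : R₁ →ₐ[ℂ] k) (g₂ : R₂ →ₐ[ℂ] k),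
      IsAlgFamily d I₁ ∧ IsAlgFamily d I₂ ∧ IsLocalHom π₁ ∧ IsLocalHom π₂ ∧
      baseIdeal π₁ I₁ = idealOf r f₁ ∧ baseIdeal π₂ I₂ = idealOf r f₂ ∧
      baseIdeal g₁ I₁ = baseIdeal g₂ I₂ := by
  let η := genericPoint H.left
  obtain ⟨π₁, h₁, e₁⟩ := exists_specMap_fromLocalRing f₁ rfl
  obtain ⟨π₂, h₂, e₂⟩ := exists_specMap_fromLocalRing f₂ rfl
  obtain ⟨g₁, e₁'⟩ := exists_localRingAt_hom
    (genericPoint_specializes (f₁.left (IsLocalRing.closedPoint ℂ)))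
  obtain ⟨g₂, e₂'⟩ := exists_localRingAt_hom
    (genericPoint_specializes (f₂.left (IsLocalRing.closedPoint ℂ)))
  -- Passing to the residue field of the generic point gives a fibre over a field, where the rank
  -- bound applies.
  let ρ := IsScalarTower.toAlgHom ℂ (LocalRingAt H η) (IsLocalRing.ResidueField (LocalRingAt H η))
  refine ⟨IsLocalRing.ResidueField (LocalRingAt H η), _, _, inferInstance, inferInstance,
    inferInstance, inferInstance, inferInstance, inferInstance, inferInstance, inferInstance,
    idealOf r (fromLocalRing H _), idealOf r (fromLocalRing H _), π₁, π₂, ρ.comp g₁, ρ.comp g₂,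
    isAlgFamily_idealOf r _, isAlgFamily_idealOf r _, h₁, h₂, ?_, ?_, ?_⟩
  · rw [baseIdeal, ← idealOf_comp, e₁]
  · rw [baseIdeal, ← idealOf_comp, e₂]
  · rw [baseIdeal, baseIdeal, ← idealOf_comp, ← idealOf_comp, specMap_comp, specMap_comp,
      Category.assoc, Category.assoc, e₁', e₂']

/-- Irreducibility would make one algebra over a field inherit both open conditions, against
`not_hasCrossRank`. -/
theorem not_irreducibleSpace (r : (hilbFunctor (specC S) d).RepresentableBy H)
    {J₁ J₂ : Ideal (ℂ ⊗[ℂ] S)} (hJ₁ : IsAlgFamily d J₁)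
    (hJ₂ : IsAlgFamily d J₂) (h₁ : (Algebra.traceForm ℂ ((ℂ ⊗[ℂ] S) ⧸ J₁)).Nondegenerate) {n : ℕ}
    (hn : 2 * d < n) (h₂ : HasCrossRank ℂ ((ℂ ⊗[ℂ] S) ⧸ J₂) n) : ¬ IrreducibleSpace H.left := by
  intro
  obtain ⟨f₁, rfl⟩ := exists_idealOf_eq r hJ₁
  obtain ⟨f₂, rfl⟩ := exists_idealOf_eq r hJ₂
  obtain ⟨k, R₁, R₂, _, _, _, _, _, _, _, _, I₁, I₂, π₁, π₂, g₁, g₂, hI₁, hI₂, _, _, e₁, e₂, e⟩ :=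
    exists_common_generization r f₁ f₂
  rw [← e₁] at h₁
  rw [← e₂] at h₂
  have h₁' := traceForm_nondegenerate_of_specialization π₁ g₁ hI₁ h₁
  have h₂' := hasCrossRank_of_specialization π₂ g₂ hI₂ h₂
  -- The two generic fibres coincide, so both conditions now concern the same algebra.
  rw [← e] at h₂'
  obtain ⟨b⟩ := hI₁.exists_basis
  obtain ⟨b', -⟩ := exists_basis_quotMap g₁ I₁ b
  have := Module.Finite.of_basis b'
  refine not_hasCrossRank h₁' ?_ h₂'
  rwa [Module.finrank_eq_card_basis b', Fintype.card_fin]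

end Reducible

theorem nonempty_and_not_irreducibleSpace {H : SchC}
    (r : (hilbFunctor twistedCone 8).RepresentableBy H) :
    Nonempty H.left ∧ ¬ IrreducibleSpace H.left := by
  constructor
  · obtain ⟨f, -⟩ := exists_idealOf_eq r isAlgFamily_pointIdeal_cone
    exact ⟨f.left (IsLocalRing.closedPoint ℂ)⟩
  · refine not_irreducibleSpace r (n := 18)
      (isAlgFamily_specialFiber evalPoints evalPoints_surjective (Pi.basisFun ℂ (Fin 8)))
      (isAlgFamily_specialFiber evalCone evalCone_surjective QuadricAlgebra.basis)
      (traceForm_nondegenerate_of_algEquiv (specialFiberEquiv _ evalPoints_surjective).symm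
        (traceForm_pi_nondegenerate 8)) (by norm_num)
      (QuadricAlgebra.hasCrossRank.of_algEquiv (specialFiberEquiv _ evalCone_surjective).symm)

/-! ### The cotangent space through homomorphisms to square zero extensions. -/

section CotangentSpace

variable {K R : Type*} [Field K] [CommRing R] [IsLocalRing R] [Algebra K R]

theorem ker_eq_maximalIdeal (π : R →ₐ[K] K) : RingHom.ker π = IsLocalRing.maximalIdeal R :=
  IsLocalRing.eq_maximalIdeal (RingHom.ker_isMaximal_of_surjective π.toRingHom
    fun a => ⟨algebraMap K R a, π.commutes a⟩)

theorem sub_algebraMap_mem_maximalIdeal (π : R →ₐ[K] K) (x : R) :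
    x - algebraMap K R (π x) ∈ IsLocalRing.maximalIdeal R := by
  rw [← ker_eq_maximalIdeal π, RingHom.mem_ker, map_sub, AlgHom.commutes, Algebra.algebraMap_self,
    RingHom.id_apply, sub_self]

/-- The class of `x - π x` in the cotangent space. -/
def differential (π : R →ₐ[K] K) : R →ₗ[K] (IsLocalRing.maximalIdeal R).Cotangent where
  toFun x := (IsLocalRing.maximalIdeal R).toCotangent ⟨_, sub_algebraMap_mem_maximalIdeal π x⟩
  map_add' x y := by
    rw [← map_add]
    congr 1
    ext
    simp
    ring
  map_smul' a x := by
    rw [RingHom.id_apply, ← LinearMap.map_smul_of_tower]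
    congr 1
    ext
    simp [Algebra.smul_def, mul_sub]

theorem differential_apply (π : R →ₐ[K] K) (x : IsLocalRing.maximalIdeal R) :
    differential π x = (IsLocalRing.maximalIdeal R).toCotangent x := by
  have hx : π x = 0 := by
    rw [← RingHom.mem_ker, ker_eq_maximalIdeal]
    exact x.2
  change (IsLocalRing.maximalIdeal R).toCotangent ⟨_, _⟩ = _
  congr 1
  ext
  simp [hx]

/-- The Leibniz rule: the difference of the two sides is the class of (x - π x)(y - π y), which lies
in 𝔪². -/
theorem differential_mul (π : R →ₐ[K] K) (x y : R) :
    differential π (x * y) = π x • differential π y + π y • differential π x := by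
  change (IsLocalRing.maximalIdeal R).toCotangent ⟨_, _⟩ =
    π x • (IsLocalRing.maximalIdeal R).toCotangent ⟨_, _⟩ +
      π y • (IsLocalRing.maximalIdeal R).toCotangent ⟨_, _⟩
  rw [← LinearMap.map_smul_of_tower, ← LinearMap.map_smul_of_tower, ← map_add,
    Ideal.toCotangent_eq]
  convert Ideal.mul_mem_mul (sub_algebraMap_mem_maximalIdeal π x)
    (sub_algebraMap_mem_maximalIdeal π y) using 1
  · exact pow_two _
  · simp [Algebra.smul_def]
    ring

/-- The homomorphism to the dual numbers given by a linear form on the cotangent space. -/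
def dualHom (π : R →ₐ[K] K) (φ : (IsLocalRing.maximalIdeal R).Cotangent →ₗ[K] K) :
    R →ₐ[K] TrivSqZeroExt K K :=
  AlgHom.ofLinearMap
    (LinearMap.toSpanSingleton K _ 1 ∘ₗ π.toLinearMap +
      TrivSqZeroExt.inrHom K K ∘ₗ φ ∘ₗ differential π)
    (by
      have : differential π 1 = 0 := by simpa using differential_mul π 1 1
      simp [this])
    (fun x y => by
      ext
      · simp
      · simp [differential_mul]
        ring)

theorem fst_dualHom (π : R →ₐ[K] K) (φ : (IsLocalRing.maximalIdeal R).Cotangent →ₗ[K] K) (x : R) :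
    (dualHom π φ x).fst = π x := by
  simp [dualHom]

theorem snd_dualHom (π : R →ₐ[K] K) (φ : (IsLocalRing.maximalIdeal R).Cotangent →ₗ[K] K) (x : R) :
    (dualHom π φ x).snd = φ (differential π x) := by
  simp [dualHom]

/-- The section π makes K → R/𝔪 bijective, so the dimension may be taken over K. -/
theorem finrank_cotangentSpace_eq_of_algHom (π : R →ₐ[K] K) :
    Module.finrank (IsLocalRing.ResidueField R) (IsLocalRing.CotangentSpace R) =
      Module.finrank K (IsLocalRing.maximalIdeal R).Cotangent := by
  refine (congrArg Cardinal.toNat (rank_eq_of_equiv_equiv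
    (algebraMap K (IsLocalRing.ResidueField R)) (AddEquiv.refl _) ⟨RingHom.injective _, ?_⟩ ?_)).symm
  · intro y
    obtain ⟨x, rfl⟩ := IsLocalRing.residue_surjective y
    refine ⟨π x, ?_⟩
    rw [IsScalarTower.algebraMap_apply K R, eq_comm, ← sub_eq_zero]
    exact (map_sub _ _ _).symm.trans
      ((IsLocalRing.residue_eq_zero_iff _).2 (sub_algebraMap_mem_maximalIdeal π x))
  · intro a m
    rw [IsScalarTower.algebraMap_apply K R]
    exact (algebraMap_smul R a m).symm

/-- If every homomorphism to the dual numbers over `π` is obtained in a unique way from a linear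
form on `V` and a fixed homomorphism to `K ⊕ V`, then the cotangent space is isomorphic to `V`. -/
theorem finrank_cotangentSpace_eq {V : Type*} [AddCommGroup V] [Module K V] [Module Kᵐᵒᵖ V]
    [IsCentralScalar K V] (g : R →ₐ[K] TrivSqZeroExt K V)
    (hinj : ∀ f : V →ₗ[K] K,
      (TrivSqZeroExt.map f).comp g = (TrivSqZeroExt.map 0).comp g → f = 0)
    (hsurj : ∀ g' : R →ₐ[K] TrivSqZeroExt K K,
      (TrivSqZeroExt.fstHom K K K).comp g' = (TrivSqZeroExt.fstHom K K V).comp g →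
        ∃ f : V →ₗ[K] K, (TrivSqZeroExt.map f).comp g = g') :
    Module.finrank (IsLocalRing.ResidueField R) (IsLocalRing.CotangentSpace R) =
      Module.finrank K V := by
  let π := (TrivSqZeroExt.fstHom K K V).comp g
  rw [finrank_cotangentSpace_eq_of_algHom π]
  let m := IsLocalRing.maximalIdeal R
  have hm (x : m) : (g x).fst = 0 := by
    have h : (x : R) ∈ RingHom.ker π := by
      rw [ker_eq_maximalIdeal]
      exact x.2
    exact h
  let δ : m →ₗ[K] V := (TrivSqZeroExt.sndHom K V) ∘ₗ g.toLinearMap ∘ₗ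
    (m.subtype.restrictScalars K)
  have hδ (x : m) : δ x = (g x).snd := rfl
  let c : m →ₗ[K] m.Cotangent := m.toCotangent.restrictScalars K
  have hc : Function.Surjective c := m.toCotangent_surjective
  have hsnd (f : V →ₗ[K] K) (y : TrivSqZeroExt K V) :
      (TrivSqZeroExt.map f y).snd = f y.snd := by simp
  -- A proper image would be killed by a nonzero linear form, contradicting `hinj`.
  have hδs : Function.Surjective δ := by
    rw [← LinearMap.range_eq_top]
    by_contra hne
    obtain ⟨f, hf, hle⟩ := Submodule.exists_le_ker_of_lt_top _ (lt_top_iff_ne_top.2 hne)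
    refine hf (hinj f (AlgHom.ext fun x => ?_))
    have h0 : f ((g x).snd) = 0 := by
      have hx : g x = g (x - algebraMap K R (π x)) + algebraMap K _ (π x) := by
        rw [map_sub, AlgHom.commutes, sub_add_cancel]
      have := hle ⟨⟨_, sub_algebraMap_mem_maximalIdeal π x⟩, rfl⟩
      rw [hx, TrivSqZeroExt.snd_add, map_add]
      refine (congrArg₂ (· + ·) this ?_).trans (add_zero _)
      simp [TrivSqZeroExt.algebraMap_eq_inl]
    ext
    · simp
    · simp [h0]
  -- Elements of 𝔪² die in V because V has square zero. Conversely, by `hsurj` every linear form on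
  -- 𝔪/𝔪² factors through δ, so an element of the kernel of δ is killed by all of them.
  have hker : LinearMap.ker c = LinearMap.ker δ := by
    apply le_antisymm
    · intro x hx
      have hx' : (x : R) ∈ m ^ 2 := (m.toCotangent_eq_zero x).1 hx
      rw [LinearMap.mem_ker, hδ]
      rw [pow_two] at hx'
      refine Submodule.mul_induction_on hx' (fun a ha b hb => ?_) (fun a b ha hb => ?_)
      · rw [map_mul, TrivSqZeroExt.snd_mul, hm ⟨a, ha⟩, hm ⟨b, hb⟩]
        simp
      · rw [map_add, TrivSqZeroExt.snd_add, ha, hb, add_zero]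
    · intro x hx
      rw [LinearMap.mem_ker] at hx ⊢
      rw [← Module.forall_dual_apply_eq_zero_iff K]
      intro φ
      obtain ⟨f, hf⟩ := hsurj (dualHom π φ) (AlgHom.ext fun x => fst_dualHom π φ x)
      have h := congrArg TrivSqZeroExt.snd (DFunLike.congr_fun hf (x : R))
      rw [snd_dualHom, differential_apply] at h
      exact h.symm.trans ((hsnd f _).trans ((congrArg f hx).trans (map_zero f)))
  exact ((c.quotKerEquivOfSurjective hc).symm.trans ((Submodule.quotEquivOfEq _ _ hker).trans
    (δ.quotKerEquivOfSurjective hδs))).finrank_eq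

end CotangentSpace

/-! ### First order deformations over the dual numbers. -/

section Deformation

variable {S : Type} [CommRing S] [Algebra ℂ S]

/-- A surjection between free modules of the same finite rank is injective. -/
theorem IsAlgFamily.eq_of_le {A : Type} [CommRing A] [Algebra ℂ A] [IsLocalRing A] {d : ℕ}
    {I I' : Ideal (A ⊗[ℂ] S)} (h : IsAlgFamily d I) (h' : IsAlgFamily d I') (hle : I ≤ I') :
    I = I' := by
  obtain ⟨b⟩ := h.exists_basis
  obtain ⟨b'⟩ := h'.exists_basis
  have := h.finite
  let f := (Ideal.Quotient.factorₐ A hle).toLinearMap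
  let e := b'.equiv b (Equiv.refl _)
  have hf : Function.Injective (e.toLinearMap ∘ₗ f) :=
    OrzechProperty.injective_of_surjective_endomorphism _
      (e.surjective.comp (Ideal.Quotient.factor_surjective hle))
  refine le_antisymm hle fun t ht => ?_
  rw [← Ideal.Quotient.eq_zero_iff_mem]
  refine hf ?_
  have h0 : f (Ideal.Quotient.mk I t) = 0 :=
    (Ideal.Quotient.factor_mk hle t).trans (Ideal.Quotient.eq_zero_iff_mem.2 ht)
  rw [LinearMap.comp_apply, h0, map_zero, map_zero]

theorem IsAlgFamily.baseIdeal {A A' : Type} [CommRing A] [Algebra ℂ A] [IsLocalRing A] [CommRing A']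
    [Algebra ℂ A'] [Nontrivial A'] (g : A →ₐ[ℂ] A') {d : ℕ} {I : Ideal (A ⊗[ℂ] S)}
    (h : IsAlgFamily d I) : IsAlgFamily d (baseIdeal g I) := by
  obtain ⟨b⟩ := h.exists_basis
  obtain ⟨b', -⟩ := exists_basis_quotMap g I b
  exact .of_basis b'

/-- The square zero extension of `ℂ` by a vector space. -/
def SqZero (V : Type) : Type := TrivSqZeroExt ℂ V

namespace SqZero

variable {V W : Type} [AddCommGroup V] [Module ℂ V] [Module ℂᵐᵒᵖ V] [IsCentralScalar ℂ V]
  [AddCommGroup W] [Module ℂ W] [Module ℂᵐᵒᵖ W] [IsCentralScalar ℂ W]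

instance : CommRing (SqZero V) := inferInstanceAs (CommRing (TrivSqZeroExt ℂ V))

instance : Algebra ℂ (SqZero V) := inferInstanceAs (Algebra ℂ (TrivSqZeroExt ℂ V))

instance : IsLocalRing (SqZero V) :=
  have : Nontrivial (SqZero V) := inferInstanceAs (Nontrivial (TrivSqZeroExt ℂ V))
  .of_isUnit_or_isUnit_one_sub_self fun a => by
    have h (x : SqZero V) : IsUnit x ↔ IsUnit (TrivSqZeroExt.fst x) :=
      TrivSqZeroExt.isUnit_iff_isUnit_fst
    rw [h, h]
    exact IsLocalRing.isUnit_or_isUnit_one_sub_self (TrivSqZeroExt.fst a)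

/-- The projection to `ℂ`. -/
def fst : SqZero V →ₐ[ℂ] ℂ := TrivSqZeroExt.fstHom ℂ ℂ V

/-- The projection to the vector space. -/
def snd : SqZero V →ₗ[ℂ] V := TrivSqZeroExt.sndHom ℂ V

/-- The inclusion of the square zero ideal. -/
def inr : V →ₗ[ℂ] SqZero V := TrivSqZeroExt.inrHom ℂ V

/-- The homomorphism of square zero extensions given by a linear map. -/
def map (f : V →ₗ[ℂ] W) : SqZero V →ₐ[ℂ] SqZero W := TrivSqZeroExt.map f

instance : IsLocalHom (fst : SqZero V →ₐ[ℂ] ℂ) :=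
  ⟨fun _ h => TrivSqZeroExt.isUnit_iff_isUnit_fst.2 h⟩

@[ext]
theorem ext {x y : SqZero V} (h : fst x = fst y) (h' : snd x = snd y) : x = y :=
  TrivSqZeroExt.ext h h'

@[simp] theorem fst_inr (v : V) : fst (inr v) = 0 := rfl
@[simp] theorem snd_inr (v : V) : snd (inr v) = v := rfl
@[simp] theorem snd_one : snd (1 : SqZero V) = 0 := rfl

@[simp] theorem snd_mul (x y : SqZero V) : snd (x * y) = fst x • snd y + fst y • snd x :=
  (TrivSqZeroExt.snd_mul x y).trans (by rw [op_smul_eq_smul]; rfl)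

@[simp] theorem snd_algebraMap (a : ℂ) : snd (algebraMap ℂ (SqZero V) a) = 0 := rfl

@[simp] theorem fst_map (f : V →ₗ[ℂ] W) (x : SqZero V) : fst (map f x) = fst x :=
  DFunLike.congr_fun (TrivSqZeroExt.fstHom_comp_map f) x

@[simp] theorem snd_map (f : V →ₗ[ℂ] W) (x : SqZero V) : snd (map f x) = f (snd x) :=
  TrivSqZeroExt.snd_map f x

theorem map_inr (f : V →ₗ[ℂ] W) (v : V) : map f (inr v) = inr (f v) := by
  ext <;> simp

theorem finrank_cotangentSpace_eq {R : Type} [CommRing R] [IsLocalRing R] [Algebra ℂ R]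
    (g : R →ₐ[ℂ] SqZero V)
    (hinj : ∀ f : V →ₗ[ℂ] ℂ, (map f).comp g = (map 0).comp g → f = 0)
    (hsurj : ∀ g' : R →ₐ[ℂ] SqZero ℂ, fst.comp g' = fst.comp g →
      ∃ f : V →ₗ[ℂ] ℂ, (map f).comp g = g') :
    Module.finrank (IsLocalRing.ResidueField R) (IsLocalRing.CotangentSpace R) =
      Module.finrank ℂ V :=
  HilbertOfPoints.finrank_cotangentSpace_eq (K := ℂ) (V := V) g hinj hsurj

end SqZero

/-- The ring of dual numbers. -/
abbrev Dual : Type := SqZero ℂ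

/-- The quotient of the dual numbers by the square zero ideal. -/
abbrev Dual.fst : Dual →ₐ[ℂ] ℂ := SqZero.fst

/-- The square zero element `ε` of the dual numbers. -/
abbrev Dual.eps : Dual := SqZero.inr 1

theorem Dual.eps_mul_eps : Dual.eps * Dual.eps = 0 := by
  ext <;> simp

theorem exists_eq_add_eps_tmul (t : Dual ⊗[ℂ] S) :
    ∃ a b : S, t = 1 ⊗ₜ a + Dual.eps ⊗ₜ b := by
  induction t with
  | zero => exact ⟨0, 0, by simp⟩
  | add t t' h h' =>
    obtain ⟨a, b, rfl⟩ := h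
    obtain ⟨a', b', rfl⟩ := h'
    exact ⟨a + a', b + b', by rw [tmul_add, tmul_add]; abel⟩
  | tmul x s =>
    refine ⟨SqZero.fst x • s, SqZero.snd x • s, ?_⟩
    rw [← smul_tmul, ← smul_tmul, ← add_tmul]
    congr 1
    ext <;> simp

theorem map_fst_add_eps_tmul (a b : S) :
    Algebra.TensorProduct.map Dual.fst (AlgHom.id ℂ S) (1 ⊗ₜ a + Dual.eps ⊗ₜ b) = 1 ⊗ₜ a := by
  simp

theorem mem_map_includeRight_iff {J : Ideal S} {s : S} :
    (1 : ℂ) ⊗ₜ[ℂ] s ∈ J.map (Algebra.TensorProduct.includeRight : S →ₐ[ℂ] ℂ ⊗[ℂ] S) ↔ s ∈ J := by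
  refine ⟨fun h => ?_, fun h => Ideal.mem_map_of_mem _ h⟩
  rw [← Ideal.Quotient.eq_zero_iff_mem]
  let f := (Ideal.Quotient.mkₐ ℂ J).comp (Algebra.TensorProduct.lid ℂ S).toAlgHom
  have hle : J.map (Algebra.TensorProduct.includeRight : S →ₐ[ℂ] ℂ ⊗[ℂ] S) ≤ RingHom.ker f := by
    rw [Ideal.map_le_iff_le_comap]
    intro x hx
    simpa [f, RingHom.mem_ker, Ideal.Quotient.eq_zero_iff_mem] using hx
  simpa [f] using hle h

variable {d : ℕ} {J : Ideal S} {I I' : Ideal (Dual ⊗[ℂ] S)}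

theorem fst_mem_of_mem
    (h : baseIdeal Dual.fst I = J.map (Algebra.TensorProduct.includeRight : S →ₐ[ℂ] ℂ ⊗[ℂ] S))
    {a b : S} (ht : (1 : Dual) ⊗ₜ a + Dual.eps ⊗ₜ b ∈ I) : a ∈ J := by
  rw [← mem_map_includeRight_iff, ← h, ← map_fst_add_eps_tmul a b]
  exact Ideal.mem_map_of_mem _ ht

theorem exists_sub_eps_tmul_mem
    (h : baseIdeal Dual.fst I = J.map (Algebra.TensorProduct.includeRight : S →ₐ[ℂ] ℂ ⊗[ℂ] S))
    {a : S} (ha : a ∈ J) : ∃ b, (1 : Dual) ⊗ₜ a - Dual.eps ⊗ₜ b ∈ I := by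
  rw [← mem_map_includeRight_iff, ← h] at ha
  have hs : Function.Surjective (Algebra.TensorProduct.map Dual.fst (AlgHom.id ℂ S)) :=
    TensorProduct.map_surjective (fun x => ⟨algebraMap ℂ _ x, rfl⟩) fun x => ⟨x, rfl⟩
  obtain ⟨t, ht, hta⟩ := (Ideal.mem_map_iff_of_surjective _ hs).1 ha
  obtain ⟨a', b, rfl⟩ := exists_eq_add_eps_tmul t
  have h1 := (map_fst_add_eps_tmul a' b).symm.trans hta
  have h2 : a' = a := by simpa using congrArg (Algebra.TensorProduct.lid ℂ S) h1
  subst h2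
  exact ⟨-b, by rwa [tmul_neg, sub_neg_eq_add]⟩

theorem eps_tmul_mem
    (h : baseIdeal Dual.fst I = J.map (Algebra.TensorProduct.includeRight : S →ₐ[ℂ] ℂ ⊗[ℂ] S))
    {a : S} (ha : a ∈ J) : Dual.eps ⊗ₜ a ∈ I := by
  obtain ⟨b, hb⟩ := exists_sub_eps_tmul_mem h ha
  simpa [mul_sub, Dual.eps_mul_eps] using I.mul_mem_left (Dual.eps ⊗ₜ 1) hb

/-- This is where flatness is used: in a free module over the dual numbers, an element killed by ε
has coordinates in (ε), hence vanishes in the special fibre. -/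
theorem mem_of_eps_tmul_mem (hI : IsAlgFamily d I)
    (h : baseIdeal Dual.fst I = J.map (Algebra.TensorProduct.includeRight : S →ₐ[ℂ] ℂ ⊗[ℂ] S))
    {a : S} (ha : Dual.eps ⊗ₜ a ∈ I) : a ∈ J := by
  obtain ⟨b⟩ := hI.exists_basis
  obtain ⟨b', hb⟩ := exists_basis_quotMap Dual.fst I b
  let x := Ideal.Quotient.mk I ((1 : Dual) ⊗ₜ a)
  have hx : Dual.eps • x = 0 := by
    have h1 : Dual.eps • x = Ideal.Quotient.mk I (Dual.eps • ((1 : Dual) ⊗ₜ a)) := rfl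
    rw [h1, smul_tmul', smul_eq_mul, mul_one, Ideal.Quotient.eq_zero_iff_mem]
    exact ha
  have h0 : quotMap Dual.fst I x = 0 := by
    apply b'.repr.injective
    ext i
    rw [repr_quotMap Dual.fst I b b' hb, map_zero, Finsupp.zero_apply]
    have := DFunLike.congr_fun (congrArg b.repr hx) i
    rw [map_smul, Finsupp.smul_apply, map_zero, Finsupp.zero_apply] at this
    simpa using congrArg SqZero.snd this
  rw [← mem_map_includeRight_iff, ← h, ← Ideal.Quotient.eq_zero_iff_mem]
  rwa [quotMap_mk, Algebra.TensorProduct.map_tmul, map_one, AlgHom.id_apply] at h0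

/-- Two first order deformations are equal if they agree on generators. -/
theorem eq_of_forall_exists {ι : Type} {f : ι → S} (hI : IsAlgFamily d I) (hI' : IsAlgFamily d I')
    (h : baseIdeal Dual.fst I = (Ideal.span (Set.range f)).map
      (Algebra.TensorProduct.includeRight : S →ₐ[ℂ] ℂ ⊗[ℂ] S))
    (h' : baseIdeal Dual.fst I' = (Ideal.span (Set.range f)).map
      (Algebra.TensorProduct.includeRight : S →ₐ[ℂ] ℂ ⊗[ℂ] S))
    (p : ι → S) (hp : ∀ i, (1 : Dual) ⊗ₜ f i - Dual.eps ⊗ₜ p i ∈ I)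
    (hp' : ∀ i, (1 : Dual) ⊗ₜ f i - Dual.eps ⊗ₜ p i ∈ I') : I = I' := by
  refine hI.eq_of_le hI' fun t ht => ?_
  -- Agreement on generators propagates to a lift of every element of the ideal that is common to
  -- `I` and `I'`.
  have key (a : S) (ha : a ∈ Ideal.span (Set.range f)) :
      ∃ b, (1 : Dual) ⊗ₜ a - Dual.eps ⊗ₜ b ∈ I ⊓ I' := by
    refine Submodule.span_induction ?_ ⟨0, by simp⟩ ?_ ?_ ha
    · rintro _ ⟨i, rfl⟩
      exact ⟨p i, hp i, hp' i⟩
    · rintro x y - - ⟨b, hb⟩ ⟨c, hc⟩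
      refine ⟨b + c, ?_⟩
      convert add_mem hb hc using 1
      rw [tmul_add, tmul_add]
      abel
    · rintro c x - ⟨b, hb⟩
      refine ⟨c * b, ?_⟩
      simpa [mul_sub] using (I ⊓ I').mul_mem_left ((1 : Dual) ⊗ₜ c) hb
  obtain ⟨a, b, rfl⟩ := exists_eq_add_eps_tmul t
  obtain ⟨c, hc⟩ := key a (fst_mem_of_mem h ht)
  have h1 : Dual.eps ⊗ₜ (b + c) ∈ I := by
    convert sub_mem ht hc.1 using 1
    rw [tmul_add]
    abel
  have h2 := eps_tmul_mem h' (mem_of_eps_tmul_mem hI h h1)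
  convert add_mem hc.2 h2 using 1
  rw [tmul_add]
  abel

/-- The values of a first order deformation satisfy the syzygies of the generators. -/
theorem sum_mul_mem_of_syzygy {ι : Type} [Fintype ι] {f : ι → S} (hI : IsAlgFamily d I)
    (h : baseIdeal Dual.fst I = J.map (Algebra.TensorProduct.includeRight : S →ₐ[ℂ] ℂ ⊗[ℂ] S))
    {p : ι → S} (hp : ∀ i, (1 : Dual) ⊗ₜ f i - Dual.eps ⊗ₜ p i ∈ I) (c : ι → S)
    (hc : ∑ i, c i * f i = 0) : ∑ i, c i * p i ∈ J := by
  apply mem_of_eps_tmul_mem hI h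
  have h1 : ∑ i, (1 : Dual) ⊗ₜ[ℂ] c i * (1 ⊗ₜ f i - Dual.eps ⊗ₜ p i) ∈ I :=
    sum_mem fun i _ => I.mul_mem_left _ (hp i)
  simp only [mul_sub, Algebra.TensorProduct.tmul_mul_tmul, one_mul, Finset.sum_sub_distrib,
    ← tmul_sum, hc, tmul_zero, zero_sub] at h1
  simpa using h1

end Deformation

/-! ### Base change of quadric algebras. -/

namespace QuadricAlgebra

section Naturality

variable {A A' : Type} [CommRing A] [Algebra ℂ A] [CommRing A'] [Algebra ℂ A']
  {q : Fin 7 → Fin 3 → A} {q' : Fin 7 → Fin 3 → A'}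

/-- Base change of a quadric algebra. -/
def mapHom (g : A →ₐ[ℂ] A') (h : ∀ j k, g (q j k) = q' j k) :
    QuadricAlgebra q →ₐ[ℂ] QuadricAlgebra q' where
  toFun x := ⟨g x.c, fun i => g (x.l i), fun k => g (x.s k)⟩
  map_one' := by ext <;> simp
  map_zero' := by ext <;> simp
  map_add' x y := by ext <;> simp
  map_mul' x y := by
    ext k
    · simp
    · simp
    · fin_cases k <;> simp [prodForm, h]
  commutes' a := by ext <;> simp [algebraMap_eq]

theorem mapHom_evalPoly (g : A →ₐ[ℂ] A') (h : ∀ j k, g (q j k) = q' j k) {t : Fin 4 → A}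
    {t' : Fin 4 → A'} (ht : ∀ i, g (t i) = t' i) (p : Poly4) :
    mapHom g h (evalPoly q t p) = evalPoly q' t' p := by
  have : (mapHom g h).comp (evalPoly q t) = evalPoly q' t' := by
    apply MvPolynomial.algHom_ext
    intro i
    rw [AlgHom.comp_apply, evalPoly_X, evalPoly_X]
    ext j
    · exact ht i
    · change g ((Pi.single i 1 : Fin 4 → A) j) = (Pi.single i 1 : Fin 4 → A') j
      rw [Pi.single_apply, Pi.single_apply]
      split_ifs <;> simp
    · exact map_zero g
  exact DFunLike.congr_fun this p

theorem baseIdeal_ker_eval_le (g : A →ₐ[ℂ] A') (h : ∀ j k, g (q j k) = q' j k) {t : Fin 4 → A}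
    {t' : Fin 4 → A'} (ht : ∀ i, g (t i) = t' i) :
    baseIdeal g (RingHom.ker (eval q t)) ≤ RingHom.ker (eval q' t') := by
  have key (x : A ⊗[ℂ] Poly4) : eval q' t' (Algebra.TensorProduct.map g (AlgHom.id ℂ Poly4) x) =
      mapHom g h (eval q t x) := by
    induction x with
    | zero => simp
    | add x y hx hy => rw [map_add, map_add, map_add, map_add, hx, hy]
    | tmul a p =>
      rw [Algebra.TensorProduct.map_tmul, eval_tmul, eval_tmul, AlgHom.id_apply,
        ← mapHom_evalPoly g h ht]
      ext <;> simp [mapHom]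
  rw [baseIdeal, Ideal.map_le_iff_le_comap]
  intro x hx
  rw [Ideal.mem_comap, RingHom.mem_ker]
  exact (key x).trans (by rw [RingHom.mem_ker.1 hx, map_zero])

/-- One inclusion suffices, because both sides define families of length 8 over a local ring. -/
theorem baseIdeal_ker_eval [IsLocalRing A] [IsLocalRing A'] (g : A →ₐ[ℂ] A')
    (h : ∀ j k, g (q j k) = q' j k) {t : Fin 4 → A} {t' : Fin 4 → A'} (ht : ∀ i, g (t i) = t' i) :
    baseIdeal g (RingHom.ker (eval q t)) = RingHom.ker (eval q' t') :=
  ((isAlgFamily_ker_eval q t).baseIdeal g).eq_of_le (isAlgFamily_ker_eval q' t')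
    (baseIdeal_ker_eval_le g h ht)

end Naturality

/-! ### The 25-parameter first order family. -/

section FirstOrder

variable {V W : Type} [AddCommGroup V] [Module ℂ V] [Module ℂᵐᵒᵖ V] [IsCentralScalar ℂ V]
  [AddCommGroup W] [Module ℂ W] [Module ℂᵐᵒᵖ W] [IsCentralScalar ℂ W]

/-- The indices of the parameters of the first order deformations: translations, and structure
constants of quadric algebras. -/
abbrev Param : Type := Fin 4 ⊕ (Fin 7 × Fin 3)

/-- The structure constants of a first order deformation. -/
def defForm (u : Param → V) (j : Fin 7) (k : Fin 3) : SqZero V :=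
  algebraMap ℂ _ (baseForm ℂ j k) + SqZero.inr (u (.inr (j, k)))

/-- The translation part of a first order deformation. -/
def defShift (u : Param → V) (i : Fin 4) : SqZero V := SqZero.inr (u (.inl i))

/-- The first order deformation of `pointIdeal` with given parameters. -/
def defIdeal (u : Param → V) : Ideal (SqZero V ⊗[ℂ] Poly4) :=
  RingHom.ker (eval (defForm u) (defShift u))

theorem isAlgFamily_defIdeal (u : Param → V) : IsAlgFamily 8 (defIdeal u) :=
  isAlgFamily_ker_eval _ _

theorem baseIdeal_map_defIdeal (u : Param → V) (f : V →ₗ[ℂ] W) :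
    baseIdeal (SqZero.map f) (defIdeal u) = defIdeal fun a => f (u a) := by
  refine baseIdeal_ker_eval _ (fun j k => ?_) fun i => SqZero.map_inr _ _
  rw [defForm, map_add, SqZero.map_inr, AlgHom.commutes]
  rfl

theorem fst_defForm (u : Param → V) (j : Fin 7) (k : Fin 3) :
    SqZero.fst (defForm u j k) = baseForm ℂ j k := by
  rw [defForm, map_add, AlgHom.commutes]
  simp

theorem fst_defShift (u : Param → V) (i : Fin 4) :
    SqZero.fst (defShift u i) = (0 : Fin 4 → ℂ) i := rfl

theorem baseIdeal_fst_defIdeal (u : Param → V) :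
    baseIdeal SqZero.fst (defIdeal u) = pointIdeal.map
      (Algebra.TensorProduct.includeRight : Poly4 →ₐ[ℂ] ℂ ⊗[ℂ] Poly4) := by
  refine (baseIdeal_ker_eval SqZero.fst (fst_defForm u) (fst_defShift u)).trans ?_
  rw [← ker_evalPoly, map_includeRight_eq_ker]
  ext x
  rw [RingHom.mem_ker, RingHom.mem_ker]
  have h : x = (1 : ℂ) ⊗ₜ[ℂ] (Algebra.TensorProduct.lid ℂ _ x) :=
    ((Algebra.TensorProduct.lid ℂ _).symm_apply_apply x).symm
  nth_rewrite 1 [h]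
  rw [eval_tmul, one_smul]
  rfl

end FirstOrder

/-! ### Values of deformations on the seven generators. -/

section Generators

open MvPolynomial

/-- The generators of `pointIdeal`. -/
def pointGen : Fin 7 → Poly4 :=
  ![X 0 ^ 2, X 1 ^ 2, X 2 ^ 2, X 3 ^ 2, X 0 * X 2, X 1 * X 3, X 0 * X 3 - X 1 * X 2]

theorem span_pointGen : Ideal.span (Set.range pointGen) = pointIdeal := by
  rw [pointIdeal]
  congr 1
  ext p
  simp [pointGen]
  tauto

/-- The values of a first order deformation with parameters `u` on the generators. -/
def defValue (u : Param → ℂ) (j : Fin 7) : QuadricAlgebra (baseForm ℂ) where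
  c := 0
  l := ![![2 * u (.inl 0), 0, 0, 0], ![0, 2 * u (.inl 1), 0, 0], ![0, 0, 2 * u (.inl 2), 0],
    ![0, 0, 0, 2 * u (.inl 3)], ![u (.inl 2), 0, u (.inl 0), 0], ![0, u (.inl 3), 0, u (.inl 1)],
    ![u (.inl 3), -u (.inl 2), -u (.inl 1), u (.inl 0)]] j
  s k := u (.inr (j, k))

/-- The generator xw - yz has all four partial derivatives independent, so its linear part alone
recovers the translation up to sign. -/
theorem defValue_injective : Function.Injective defValue := by
  intro u u' h
  have hl (j : Fin 7) (i : Fin 4) : (defValue u j).l i = (defValue u' j).l i := by rw [h]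
  have hs (j : Fin 7) (k : Fin 3) : (defValue u j).s k = (defValue u' j).s k := by rw [h]
  ext a
  obtain i | ⟨j, k⟩ := a
  · fin_cases i
    · exact hl 6 3
    · simpa [defValue] using hl 6 2
    · simpa [defValue] using hl 6 1
    · exact hl 6 0
  · exact hs j k

theorem evalPoly_pointGen (u : Param → ℂ) (j : Fin 7) :
    evalPoly (defForm u) (defShift u) (pointGen j) =
      ⟨SqZero.inr (defValue u j).c, fun i => SqZero.inr ((defValue u j).l i),
        fun k => SqZero.inr ((defValue u j).s k)⟩ := by
  fin_cases j <;>
  · simp only [pointGen, Fin.reduceFinMk, Fin.zero_eta, Fin.mk_one, Matrix.cons_val, pow_two,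
      map_sub, map_mul, evalPoly_X]
    refine QuadricAlgebra.ext ?_ (funext fun k => ?_) (funext fun k => ?_)
    · ext <;> simp [defShift, defValue, sub_eq_add_neg]
    · fin_cases k <;> ext <;> simp [defShift, defValue, sub_eq_add_neg, two_mul]
    · fin_cases k <;> ext <;> simp [defShift, defForm, defValue, sub_s, prodForm, baseForm]

/-- Multiplication by ε sees only the special fibre, so membership compares the class of `p` modulo
the ideal of Z with the ε-part of the deformed generator. -/
theorem sub_mem_defIdeal_iff (u : Param → ℂ) (j : Fin 7) (p : Poly4) :
    (1 : Dual) ⊗ₜ pointGen j - Dual.eps ⊗ₜ p ∈ defIdeal u ↔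
      evalPoly (baseForm ℂ) 0 p = defValue u j := by
  have h (x : Dual) : Dual.eps * x = SqZero.inr (SqZero.fst x) := by
    ext <;> simp
  rw [defIdeal, RingHom.mem_ker, map_sub, eval_tmul, eval_tmul, one_smul, sub_eq_zero,
    evalPoly_pointGen, ← mapHom_evalPoly SqZero.fst (fst_defForm u) (fst_defShift u),
    QuadricAlgebra.ext_iff, QuadricAlgebra.ext_iff, funext_iff, funext_iff, funext_iff, funext_iff]
  have hi (a b : ℂ) : (SqZero.inr a : Dual) = SqZero.inr b ↔ b = a :=
    ⟨fun e => (congrArg SqZero.snd e).symm, fun e => by rw [e]⟩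
  simp only [smul_c, smul_l, smul_s, Pi.smul_apply, smul_eq_mul, h, hi]
  rfl

/-- The eight relations used form a basis of the linear syzygies: 4 · 7 products map onto the 20
cubics. They force the constant parts to vanish and the linear parts to come from a translation. The
degree two parts are unconstrained, since linear coefficients annihilate them. -/
theorem exists_eq_defValue {g : Fin 7 → QuadricAlgebra (baseForm ℂ)}
    (h : ∀ c : Fin 7 → Poly4, ∑ j, c j * pointGen j = 0 →
      ∑ j, evalPoly (baseForm ℂ) 0 (c j) * g j = 0) : ∃ u, defValue u = g := by
  have h1 := h ![X 2, 0, 0, 0, -X 0, 0, 0] (by simp [pointGen, Fin.sum_univ_succ]; ring)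
  have h2 := h ![0, 0, X 0, 0, -X 2, 0, 0] (by simp [pointGen, Fin.sum_univ_succ]; ring)
  have h3 := h ![0, X 3, 0, 0, 0, -X 1, 0] (by simp [pointGen, Fin.sum_univ_succ]; ring)
  have h4 := h ![0, 0, 0, X 1, 0, -X 3, 0] (by simp [pointGen, Fin.sum_univ_succ]; ring)
  have h5 := h ![-X 3, 0, 0, 0, X 1, 0, X 0] (by simp [pointGen, Fin.sum_univ_succ]; ring)
  have h6 := h ![0, X 2, 0, 0, 0, -X 0, X 1] (by simp [pointGen, Fin.sum_univ_succ]; ring)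
  have h7 := h ![0, 0, X 1, 0, -X 3, 0, X 2] (by simp [pointGen, Fin.sum_univ_succ]; ring)
  have h8 := h ![0, 0, 0, -X 0, 0, X 2, X 3] (by simp [pointGen, Fin.sum_univ_succ]; ring)
  simp only [Fin.sum_univ_succ, QuadricAlgebra.ext_iff, funext_iff, Fin.forall_fin_succ]
    at h1 h2 h3 h4 h5 h6 h7 h8
  simp [evalPoly_X, prodForm_baseForm] at h1 h2 h3 h4 h5 h6 h7 h8
  -- The translation is read off the linear parts of the generators xz and yw.
  refine ⟨Sum.elim ![(g 4).l 2, (g 5).l 3, (g 4).l 0, (g 5).l 1] fun a => (g a.1).s a.2,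
    funext fun j => ?_⟩
  refine QuadricAlgebra.ext ?_ (funext fun i => ?_) rfl
  · fin_cases j <;> simp [defValue, h1, h2, h3, h4, h5]
  · fin_cases j <;> fin_cases i <;> simp [defValue] <;> grind

end Generators
end QuadricAlgebra

open QuadricAlgebra

/-! ### The explicit family contains each first order deformation of Z exactly once. -/

section DefIdeal

theorem defIdeal_injective : Function.Injective (defIdeal (V := ℂ)) := by
  intro u u' h
  refine defValue_injective (funext fun j => ?_)
  obtain ⟨p, hp⟩ := exists_sub_eps_tmul_mem (baseIdeal_fst_defIdeal u)
    (a := pointGen j) (by rw [← span_pointGen]; exact Ideal.subset_span ⟨j, rfl⟩)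
  have hp' := hp
  rw [h, sub_mem_defIdeal_iff] at hp'
  rw [sub_mem_defIdeal_iff] at hp
  rw [← hp, hp']

theorem exists_defIdeal_eq {I : Ideal (Dual ⊗[ℂ] Poly4)} (hI : IsAlgFamily 8 I)
    (h : baseIdeal Dual.fst I = pointIdeal.map
      (Algebra.TensorProduct.includeRight : Poly4 →ₐ[ℂ] ℂ ⊗[ℂ] Poly4)) :
    ∃ u : Param → ℂ, defIdeal u = I := by
  have hgen (j) : pointGen j ∈ pointIdeal := by
    rw [← span_pointGen]; exact Ideal.subset_span ⟨j, rfl⟩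
  choose p hp using fun j => exists_sub_eps_tmul_mem h (hgen j)
  obtain ⟨u, hu⟩ := exists_eq_defValue (g := fun j => evalPoly (baseForm ℂ) 0 (p j)) fun c hc => by
    have := sum_mul_mem_of_syzygy hI h hp c hc
    rw [← ker_evalPoly, RingHom.mem_ker, map_sum] at this
    simpa using this
  refine ⟨u, eq_of_forall_exists (isAlgFamily_defIdeal u) hI (f := pointGen) ?_ ?_ p
    (fun j => ?_) hp⟩
  · rw [span_pointGen, baseIdeal_fst_defIdeal]
  · rw [span_pointGen, h]
  · rw [sub_mem_defIdeal_iff, hu]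

end DefIdeal

/-! ### Local rings of the Hilbert scheme and the tangent space at Z. -/

section LocalRing

variable {S : Type} [CommRing S] [Algebra ℂ S] {d : ℕ} {H : SchC}

/-- The local ring of the Hilbert scheme at `x` represents the deformations of the subscheme
corresponding to `x`. -/
theorem exists_hom_of_isAlgFamily (r : (hilbFunctor (specC S) d).RepresentableBy H)
    (f : specC ℂ ⟶ H) {A : Type} [CommRing A] [Algebra ℂ A] [IsLocalRing A] (ρ : A →ₐ[ℂ] ℂ)
    [IsLocalHom ρ] {I : Ideal (A ⊗[ℂ] S)} (hI : IsAlgFamily d I) (h : baseIdeal ρ I = idealOf r f)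
    {x : H.left} (hx : f.left (IsLocalRing.closedPoint ℂ) = x) :
    ∃ g : LocalRingAt H x →ₐ[ℂ] A, specMap (ρ.comp g) ≫ fromLocalRing H x = f ∧
      baseIdeal g (idealOf r (fromLocalRing H x)) = I := by
  obtain ⟨F, rfl⟩ := exists_idealOf_eq r hI
  have hF : specMap ρ ≫ F = f := idealOf_injective r (by rw [idealOf_comp]; exact h)
  -- Since ρ is local, the closed point of `Spec A` is the image of that of `Spec ℂ`; this lets `F`
  -- factor through the local ring at `x`.
  have hpt : F.left (IsLocalRing.closedPoint A) = x := by
    subst hx hF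
    have hρ : IsLocalHom (CommRingCat.ofHom ρ.toRingHom).hom :=
      ⟨fun a ha => IsLocalHom.map_nonunit (f := ρ) a ha⟩
    change _ = F.left (Spec.map (CommRingCat.ofHom ρ.toRingHom) (IsLocalRing.closedPoint ℂ))
    exact congrArg _ (IsLocalRing.comap_closedPoint (CommRingCat.ofHom ρ.toRingHom).hom).symm
  obtain ⟨g, -, hg⟩ := exists_specMap_fromLocalRing F hpt
  refine ⟨g, ?_, ?_⟩
  · rw [specMap_comp, Category.assoc, hg, hF]
  · rw [baseIdeal, ← idealOf_comp, hg]

theorem algHom_ext_of_baseIdeal_eq (r : (hilbFunctor (specC S) d).RepresentableBy H) {x : H.left}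
    {A : Type} [CommRing A] [Algebra ℂ A] {g g' : LocalRingAt H x →ₐ[ℂ] A}
    (h : baseIdeal g (idealOf r (fromLocalRing H x)) =
      baseIdeal g' (idealOf r (fromLocalRing H x))) : g = g' := by
  refine specMap_fromLocalRing_injective (idealOf_injective r ?_)
  rw [idealOf_comp, idealOf_comp]
  exact h

theorem baseIdeal_comp {A A' A'' : Type} [CommRing A] [Algebra ℂ A] [CommRing A'] [Algebra ℂ A']
    [CommRing A''] [Algebra ℂ A''] (g : A →ₐ[ℂ] A') (g' : A' →ₐ[ℂ] A'') (I : Ideal (A ⊗[ℂ] S)) :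
    baseIdeal (g'.comp g) I = baseIdeal g' (baseIdeal g I) := by
  rw [baseIdeal, baseIdeal, baseIdeal, Ideal.map_mapₐ, ← Algebra.TensorProduct.map_comp]
  rfl

end LocalRing

/-- The family over ℂ ⊕ V, with V = ℂ²⁵ and the standard basis vectors as parameters, is universal
to first order: a linear form on V induces the deformation whose parameters are its values on the
basis. -/
theorem finrank_cotangentSpace_localRingAt {H : SchC}
    (r : (hilbFunctor affine4 8).RepresentableBy H) (f : specC ℂ ⟶ H)
    (hf : idealOf r f = pointIdeal.map
      (Algebra.TensorProduct.includeRight : Poly4 →ₐ[ℂ] ℂ ⊗[ℂ] Poly4))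
    {x : H.left} (hx : f.left (IsLocalRing.closedPoint ℂ) = x) :
    Module.finrank (IsLocalRing.ResidueField (LocalRingAt H x))
      (IsLocalRing.CotangentSpace (LocalRingAt H x)) = 25 := by
  let u (a : Param) : Param → ℂ := Pi.single a 1
  obtain ⟨g, hg, hgI⟩ := exists_hom_of_isAlgFamily r f SqZero.fst (isAlgFamily_defIdeal u)
    (by rw [hf, baseIdeal_fst_defIdeal]) hx
  have hmap (φ : (Param → ℂ) →ₗ[ℂ] ℂ) : baseIdeal ((SqZero.map φ).comp g)
      (idealOf r (fromLocalRing H x)) = defIdeal fun a => φ (u a) := by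
    rw [baseIdeal_comp, hgI, baseIdeal_map_defIdeal]
  refine (SqZero.finrank_cotangentSpace_eq g (fun φ h => ?_) fun g' h => ?_).trans ?_
  · have h1 := congrArg (fun k => baseIdeal k (idealOf r (fromLocalRing H x))) h
    have h2 := defIdeal_injective ((hmap φ).symm.trans (h1.trans (hmap 0)))
    exact (Pi.basisFun ℂ Param).ext fun a => by simpa [u] using congrFun h2 a
  · have h1 : specMap (Dual.fst.comp g') ≫ fromLocalRing H x = f := by rw [h, hg]
    have hI : IsAlgFamily 8 (baseIdeal g' (idealOf r (fromLocalRing H x))) := by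
      rw [baseIdeal, ← idealOf_comp]
      exact isAlgFamily_idealOf r _
    obtain ⟨v, hv⟩ := exists_defIdeal_eq hI (by
      rw [← hf, ← h1, idealOf_comp, ← baseIdeal_comp])
    refine ⟨(Pi.basisFun ℂ Param).constr ℂ v, algHom_ext_of_baseIdeal_eq r ?_⟩
    rw [hmap, ← hv]
    congr 1
    ext a
    exact (congrArg _ (Pi.basisFun_apply ℂ Param a).symm).trans (Module.Basis.constr_basis ..)
  · rw [Module.finrank_fintype_fun_eq_card]
    rfl

theorem tangentDim_pointIdeal {H : SchC} (r : (hilbFunctor affine4 8).RepresentableBy H)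
    (z : (hilbFunctor affine4 8).obj (Opposite.op ptC)) (hz : z.1 = closedSubscheme pointIdeal) :
    tangentDim H.left (imagePoint (r.homEquiv.symm z)) = 25 := by
  have h := finrank_cotangentSpace_localRingAt r _ (idealOf_ptIso_comp r z hz)
    rfl
  exact Subspace.dual_finrank_eq.trans h

end HilbertOfPoints
end

theorem mainTheorem7 :
    (∀ H : HilbertOfPoints.SchC,
      (HilbertOfPoints.hilbFunctor HilbertOfPoints.twistedCone 8).RepresentableBy H →
        Nonempty H.left ∧ ¬ IrreducibleSpace H.left) ∧
    HilbertOfPoints.coneIdeal ≤ HilbertOfPoints.pointIdeal ∧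
    Module.finrank ℂ (HilbertOfPoints.Poly4 ⧸ HilbertOfPoints.pointIdeal) = 8 ∧
    (∃ z : (HilbertOfPoints.hilbFunctor HilbertOfPoints.twistedCone 8).obj
        (Opposite.op HilbertOfPoints.ptC),
      z.1 = HilbertOfPoints.closedSubscheme
        (HilbertOfPoints.pointIdeal.map (Ideal.Quotient.mk HilbertOfPoints.coneIdeal))) ∧
    (∃ z : (HilbertOfPoints.hilbFunctor HilbertOfPoints.affine4 8).obj
        (Opposite.op HilbertOfPoints.ptC),
      z.1 = HilbertOfPoints.closedSubscheme HilbertOfPoints.pointIdeal ∧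
      ∀ (H : HilbertOfPoints.SchC)
        (r : (HilbertOfPoints.hilbFunctor HilbertOfPoints.affine4 8).RepresentableBy H),
        HilbertOfPoints.tangentDim H.left
            (HilbertOfPoints.imagePoint (r.homEquiv.symm z)) = 25 ∧
          HilbertOfPoints.tangentDim H.left
            (HilbertOfPoints.imagePoint (r.homEquiv.symm z)) < 4 * 8) := by
  open HilbertOfPoints in
  refine ⟨fun H r => nonempty_and_not_irreducibleSpace r, coneIdeal_le_pointIdeal,
    finrank_quotient_pointIdeal,
    ⟨⟨closedSubscheme _, isFamily_closedSubscheme isAlgFamily_pointIdeal_cone⟩, rfl⟩,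
    ⟨closedSubscheme pointIdeal, isFamily_closedSubscheme isAlgFamily_pointIdeal⟩, rfl,
    fun H r => ?_⟩
  have h := tangentDim_pointIdeal r ⟨closedSubscheme pointIdeal,
    isFamily_closedSubscheme isAlgFamily_pointIdeal⟩ rfl
  exact ⟨h, h.trans_lt (by norm_num)⟩
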